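/- **Definitions.** A labelled hypermap of degree $d$ with $n\ge 1$ black faces is a triple $(\sigma_0,\sigma_1,\sigma_\infty)\in S_d^3$ with $\sigma_0\sigma_1\sigma_\infty=\mathrm{Id}$, together with a labelling by $1,\dots,n$ of the disjoint cycles of $\sigma_1$ (fixed points count as cycles of length one), of which there are $n$. It is connected if $\sigma_0,\sigma_1,\sigma_\infty$ generate a transitive subgroup of $S_d$. A connected hypermap has genus $g$ if $c(\sigma_0)+c(\sigma_1)+c(\sigma_\infty)=d+2-2g$, where $c$ is the number of cycles. Two labelled hypermaps are equivalent if a simultaneous conjugation carries the permutations and the labelling of one to those of the other; $\mathrm{Aut}$ is the group of self-equivalences. For a multiset $\{a_1,\dots,a_m\}$ and a tuple $(b_1,\dots,b_n)$, let $\mathcal M_{g,m,n}(a_1,\dots,a_m|b_1,\dots,b_n)$ be the sum of $1/|\mathrm{Aut}|$ over equivalence classes of connected labelled hypermaps of genus $g$ such that the cycles of $\sigma_\infty$ (unlabelled) have lengths $a_1,\dots,a_m$ and the cycle of $\sigma_1$ labelled $j$ has length $b_j$. Fix an integer $a\ge 1$, let $t_1,\dots,t_a$ and $\hbar$ be formal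 parameters, and for $g\ge 0$, $n\ge 1$ put $$\Omega^{(a)}_{g,n}(x_1,\dots,x_n)=\sum_{m\ge 0}\ \sum_{\{a_1,\dots,a_m\}\subset\{1,\dots,a\}}\ \sum_{b_1,\dots,b_n\ge 0}\mathcal M_{g,m,n}(a_1,\dots,a_m|b_1,\dots,b_n)\prod_{i=1}^m t_{a_i}\prod_{j=1}^n b_j\,x_j^{-b_j-1},$$ where the second sum is over multisets of size $m$. Let $$F^{(a)}_{g,n}(x)=\delta_{g,0}\delta_{n,1}\log x+\int^{x}\!\!\cdots\int^{x}\Omega^{(a)}_{g,n}(x_1,\dots,x_n)\,dx_1\cdots dx_n,$$ where the integrals are termwise primitives without integration constants, i.e. $\int^x x_j^{-b-1}dx_j=-x^{-b}/b$ for $b\ge 1$. The wave function is the formal expression $$Z^{(a)}(x,\hbar)=\exp\Big[\sum_{g\ge 0}\sum_{n\ge 1}\frac{\hbar^{2g+n-2}}{n!}F^{(a)}_{g,n}(x)\Big].$$ The exponent is $\hbar^{-1}\log x$ plus a power series in $x^{-1}$, without constant term, over $\mathbb Q[t_1,\dots,t_a][\hbar,\hbar^{-1}]$, each coefficient being a finite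 sum. The exponential is taken in the ring of formal power series in $x^{-1}$ and $\log x$, with $\frac{d}{dx}x^{-1}=-x^{-2}$ and $\frac{d}{dx}\log x=x^{-1}$. **Theorem.** For every integer $a\ge 1$, the wave function satisfies $$\Big(-\hbar x\frac{d}{dx}+1+\sum_{i=1}^a t_i\Big(\hbar\frac{d}{dx}\Big)^i\Big)Z^{(a)}(x,\hbar)=0 .$$ -/

import Mathlib

open Finset

noncomputable section

namespace Hypermap

/-! ### Labelled hypermaps and their weighted enumeration -/

/-- The multiset of all cycle lengths of a permutation, fixed points included as cycles of
length one. -/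
def cycleLengths {d : ℕ} (s : Equiv.Perm (Fin d)) : Multiset ℕ := s.partition.parts

/-- A labelled hypermap of degree `d`: a triple of permutations with product the identity,
together with a labelling of the disjoint cycles of `s1` by `Fin n`. The labelling is recorded as
a map `label : Fin d → Fin n` whose fibres are exactly the cycles of `s1`
(fixed points count as cycles). -/
@[ext]
structure LabelledHypermap (d n : ℕ) where
  s0 : Equiv.Perm (Fin d)
  s1 : Equiv.Perm (Fin d)
  sinf : Equiv.Perm (Fin d)
  mul_eq_one : s0 * s1 * sinf = 1
  label : Fin d → Fin n
  label_surjective : Function.Surjective label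
  label_eq_iff : ∀ i j, label i = label j ↔ s1.SameCycle i j

variable {d n : ℕ}

instance : Finite (LabelledHypermap d n) :=
  Finite.of_injective
    (fun H : LabelledHypermap d n => (H.s0, H.s1, H.sinf, H.label))
    (fun H K h => by
      simp only [Prod.mk.injEq] at h
      exact LabelledHypermap.ext h.1 h.2.1 h.2.2.1 h.2.2.2)

/-- Relabelling of the sheets: `τ` conjugates the three permutations and transports the
labelling. Two labelled hypermaps are equivalent when they are in the same orbit, and the
automorphism group of a labelled hypermap is its stabilizer. -/
instance : MulAction (Equiv.Perm (Fin d)) (LabelledHypermap d n) where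
  smul τ H :=
    { s0 := τ * H.s0 * τ⁻¹
      s1 := τ * H.s1 * τ⁻¹
      sinf := τ * H.sinf * τ⁻¹
      mul_eq_one := by
        have h := congrArg (fun s => τ * s * τ⁻¹) H.mul_eq_one
        simpa [mul_assoc] using h
      label := fun i => H.label (τ⁻¹ i)
      label_surjective := H.label_surjective.comp (τ⁻¹).surjective
      label_eq_iff := fun i j => by
        rw [H.label_eq_iff, Equiv.Perm.sameCycle_conj] }
  one_smul H := by
    refine LabelledHypermap.ext ?_ ?_ ?_ ?_
    · change 1 * H.s0 * 1⁻¹ = H.s0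
      simp
    · change 1 * H.s1 * 1⁻¹ = H.s1
      simp
    · change 1 * H.sinf * 1⁻¹ = H.sinf
      simp
    · rfl
  mul_smul τ υ H := by
    refine LabelledHypermap.ext ?_ ?_ ?_ ?_
    · change (τ * υ) * H.s0 * (τ * υ)⁻¹ = τ * (υ * H.s0 * υ⁻¹) * τ⁻¹
      simp [mul_assoc]
    · change (τ * υ) * H.s1 * (τ * υ)⁻¹ = τ * (υ * H.s1 * υ⁻¹) * τ⁻¹
      simp [mul_assoc]
    · change (τ * υ) * H.sinf * (τ * υ)⁻¹ = τ * (υ * H.sinf * υ⁻¹) * τ⁻¹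
      simp [mul_assoc]
    · rfl

namespace LabelledHypermap

/-- The three permutations generate a transitive group. -/
def IsConnected (H : LabelledHypermap d n) : Prop :=
  MulAction.IsPretransitive
    (Subgroup.closure ({H.s0, H.s1, H.sinf} : Set (Equiv.Perm (Fin d)))) (Fin d)

/-- The covering surface has genus `g`, by the Riemann–Hurwitz formula
`c(s0) + c(s1) + c(sinf) = d + 2 - 2 g`, where `c` is the number of cycles. -/
def HasGenus (H : LabelledHypermap d n) (g : ℕ) : Prop :=
  (cycleLengths H.s0).card + (cycleLengths H.s1).card + (cycleLengths H.sinf).card + 2 * g = d + 2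

/-- The length of the cycle of `s1` with label `j`. -/
def cycleLength (H : LabelledHypermap d n) (j : Fin n) : ℕ :=
  (univ.filter fun i => H.label i = j).card

end LabelledHypermap

/-- The connected labelled hypermaps of genus `g` such that the `j`-th cycle of `s1` has length
`b j` and the (unlabelled) cycles of `sinf` have the multiset of lengths `α`. -/
def hypermapsOfType (g n : ℕ) (α : Multiset ℕ) (b : Fin n → ℕ) :
    Set (LabelledHypermap (∑ j, b j) n) :=
  {H | H.IsConnected ∧ H.HasGenus g ∧ cycleLengths H.sinf = α ∧ ∀ j, H.cycleLength j = b j}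

/-- The weighted count `M_{g,m,n}(α | b_1, …, b_n)` with `m = α.card`: the sum over equivalence
classes of connected labelled hypermaps of the given type of the inverse order of the
automorphism group. -/
def weightedCount (g n : ℕ) (α : Multiset ℕ) (b : Fin n → ℕ) : ℚ :=
  ∑ᶠ o ∈ (Quotient.mk (MulAction.orbitRel (Equiv.Perm (Fin (∑ j, b j)))
      (LabelledHypermap (∑ j, b j) n))) '' hypermapsOfType g n α b,
    (Nat.card (MulAction.stabilizer (Equiv.Perm (Fin (∑ j, b j))) (Quotient.out o)) : ℚ)⁻¹

/-! ### Correlation functions -/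

/-- The ring containing the formal parameters `t_1, t_2, …`; `t_i` is `MvPolynomial.X i`. -/
abbrev TRing : Type := MvPolynomial ℕ ℚ

/-- The coefficient `∑_m ∑_{1 ≤ a_1, …, a_m ≤ a} M_{g,m,n}(a_1, …, a_m | b) t_{a_1} ⋯ t_{a_m}`, the
inner sum being over unordered tuples. As `M` vanishes unless `a_1 + ⋯ + a_m = b_1 + ⋯ + b_n`,
this is a sum over partitions of `b_1 + ⋯ + b_n`. -/
def countPoly (a g n : ℕ) (b : Fin n → ℕ) : TRing :=
  ∑ p ∈ (univ : Finset (∑ j, b j).Partition).filter (fun p => ∀ i ∈ p.parts, i ≤ a),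
    MvPolynomial.C (weightedCount g n p.parts b) *
      (p.parts.map fun i => (MvPolynomial.X i : TRing)).prod

/-- The `n`-point correlation function `Ω_{g,n}^{(a)}(x_1, …, x_n)` as a power series in the
variables `x_j⁻¹`: the coefficient of `∏_j x_j ^ (-b_j - 1)` is
`b_1 ⋯ b_n * countPoly a g n b`. -/
def Omega (a g n : ℕ) : MvPowerSeries (Fin n) TRing := fun e =>
  if ∀ j, 1 ≤ e j then
    (∏ j, ((e j - 1 : ℕ) : ℚ)) • countPoly a g n (fun j => e j - 1)
  else 0

/-- The iterated termwise primitive `∫^{x_1} ⋯ ∫^{x_n}` without integration constants, on series in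
`x_j⁻¹`: `x_j ^ (-b - 1)` becomes `-x_j ^ (-b) / b` for `b ≥ 1`. It is applied only to `Omega`,
which has no term in which some `x_j` has exponent `-1` or `0` (see `coeff_Omega_eq_zero`). -/
def primitive {n : ℕ} (f : MvPowerSeries (Fin n) TRing) : MvPowerSeries (Fin n) TRing := fun e =>
  (∏ j, -((e j : ℚ)⁻¹)) • MvPowerSeries.coeff (e + Finsupp.equivFunOnFinite.symm fun _ => 1) f

lemma coeff_Omega_eq_zero (a g n : ℕ) (e : Fin n →₀ ℕ) (j : Fin n) (h : e j ≤ 1) :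
    MvPowerSeries.coeff e (Omega a g n) = 0 := by
  change (if ∀ j, 1 ≤ e j then
    (∏ j, ((e j - 1 : ℕ) : ℚ)) • countPoly a g n (fun j => e j - 1) else 0) = 0
  split_ifs
  · rw [Finset.prod_eq_zero (mem_univ j), zero_smul]
    exact_mod_cast Nat.sub_eq_zero_of_le h
  · rfl

/-! ### The ring of formal series in `1/x` and `log x` -/

/-- Formal power series over `R` in two variables: `MvPowerSeries.X 0` is `x⁻¹` and
`MvPowerSeries.X 1` is `log x`. -/
abbrev LogSeries (R : Type) : Type := MvPowerSeries (Fin 2) R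

variable {R : Type} [CommRing R]

/-- The series `x⁻¹`. -/
def invx : LogSeries R := MvPowerSeries.X 0

/-- The series `log x`. -/
def logx : LogSeries R := MvPowerSeries.X 1

/-- The derivation `d/dx`: it sends `x⁻¹` to `-x⁻²` and `log x` to `x⁻¹`. -/
def ddx : Derivation R (LogSeries R) (LogSeries R) :=
  (-(invx ^ 2) : LogSeries R) • MvPowerSeries.pderiv R 0 +
    (invx : LogSeries R) • MvPowerSeries.pderiv R 1

/-- The derivation `x d/dx`: it sends `x⁻¹` to `-x⁻¹` and `log x` to `1`. -/
def xddx : Derivation R (LogSeries R) (LogSeries R) :=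
  (-invx : LogSeries R) • MvPowerSeries.pderiv R 0 + MvPowerSeries.pderiv R 1

lemma ddx_invx : ddx (invx : LogSeries R) = -invx ^ 2 := by
  simp [ddx, invx]

lemma ddx_logx : ddx (logx : LogSeries R) = invx := by
  simp [ddx, logx]

lemma ddx_eq_invx_mul_xddx (f : LogSeries R) : ddx f = invx * xddx f := by
  simp only [ddx, xddx, Derivation.add_apply, Derivation.smul_apply, smul_eq_mul]
  ring

/-- Setting `x_1 = ⋯ = x_n = x` in a power series in the `x_j⁻¹`. -/
def principalSpecialization {n : ℕ} (f : MvPowerSeries (Fin n) R) : LogSeries R := fun e =>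
  if e 1 = 0 then
    ∑ b ∈ (univ : Finset (Fin n)).finsuppAntidiag (e 0), MvPowerSeries.coeff b f
  else 0

/-! ### The wave function -/

/-- `F_{g,n}^{(a)}(x)`, with the additional term `log x` for `(g,n) = (0,1)`. -/
def freeEnergy (a g n : ℕ) : LogSeries TRing :=
  (if g = 0 ∧ n = 1 then logx else 0) + principalSpecialization (primitive (Omega a g n))

/-- The coefficient ring `ℚ[t_1, t_2, …][ħ, ħ⁻¹]`. -/
abbrev HRing : Type := LaurentPolynomial TRing

/-- The formal parameter `t_i`. -/
def t (i : ℕ) : HRing := LaurentPolynomial.C (MvPolynomial.X i)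

/-- The formal parameter `ħ`. -/
def hbar : HRing := LaurentPolynomial.T 1

/-- The term `ħ ^ (2g + n - 2) / n! * F_{g,n}^{(a)}(x)`. -/
def waveTerm (a g n : ℕ) : LogSeries HRing :=
  (LaurentPolynomial.T (2 * (g : ℤ) + (n : ℤ) - 2) *
      algebraMap ℚ HRing ((n.factorial : ℚ)⁻¹)) •
    MvPowerSeries.map (LaurentPolynomial.C : TRing →+* HRing) (freeEnergy a g n)

/-- The exponent `∑_{g ≥ 0} ∑_{n ≥ 1} ħ ^ (2g + n - 2) / n! * F_{g,n}^{(a)}(x)`. The sum is taken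
coefficientwise; each coefficient is a finite sum by `finite_support_waveTerm`. -/
def waveExponent (a : ℕ) : LogSeries HRing := fun e =>
  ∑ᶠ p : ℕ × ℕ+, MvPowerSeries.coeff e (waveTerm a p.1 p.2)

/-- The wave function `Z^{(a)}(x, ħ)`, the exponential of `waveExponent a`, which has zero constant
term by `constantCoeff_waveExponent`. -/
def waveFunction (a : ℕ) : LogSeries HRing :=
  (PowerSeries.exp HRing).subst (waveExponent a)

lemma weightedCount_eq_zero (g n : ℕ) (α : Multiset ℕ) (b : Fin n → ℕ) (hn : 0 < n)
    (hb : ∑ j, b j < 2 * g) : weightedCount g n α b = 0 := by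
  have hempty : hypermapsOfType g n α b = ∅ := by
    rw [Set.eq_empty_iff_forall_notMem]
    rintro H ⟨-, hg, -, -⟩
    obtain ⟨i, -⟩ := H.label_surjective ⟨0, hn⟩
    have hpos : ∀ s : Equiv.Perm (Fin (∑ j, b j)), 1 ≤ (cycleLengths s).card := by
      intro s
      rw [Nat.one_le_iff_ne_zero, Ne, Multiset.card_eq_zero]
      intro h0
      have h1 := s.partition.parts_sum
      change (cycleLengths s).sum = _ at h1
      rw [h0, Multiset.sum_zero, Fintype.card_fin] at h1
      exact absurd i.isLt (by omega)
    have h0 := hpos H.s0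
    have h1 := hpos H.s1
    have h2 := hpos H.sinf
    unfold LabelledHypermap.HasGenus at hg
    omega
  rw [weightedCount, hempty, Set.image_empty]
  simp

lemma coeff_primitive_Omega_eq_zero (a g n : ℕ) (e : Fin n →₀ ℕ) (hn : 0 < n)
    (h : (∃ j, e j = 0) ∨ ∑ j, e j < 2 * g) :
    MvPowerSeries.coeff e (primitive (Omega a g n)) = 0 := by
  change (∏ j, -((e j : ℚ)⁻¹)) •
    MvPowerSeries.coeff (e + Finsupp.equivFunOnFinite.symm fun _ => 1) (Omega a g n) = 0
  rcases h with ⟨j, hj⟩ | h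
  · rw [coeff_Omega_eq_zero a g n _ j (by simp [hj]), smul_zero]
  · have h0 : MvPowerSeries.coeff (e + Finsupp.equivFunOnFinite.symm fun _ => 1)
        (Omega a g n) = 0 := by
      change (if _ then _ else _) = _
      split_ifs
      · have hc : countPoly a g n
            (fun j => (e + Finsupp.equivFunOnFinite.symm (fun _ => 1) : Fin n →₀ ℕ) j - 1) = 0 := by
          unfold countPoly
          refine Finset.sum_eq_zero fun p _ => ?_
          rw [weightedCount_eq_zero _ _ _ _ hn (by simpa using h)]
          simp
        rw [hc, smul_zero]
      · rfl
    rw [h0, smul_zero]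

lemma coeff_principalSpecialization_eq_zero (a g n : ℕ) (e : Fin 2 →₀ ℕ) (hn : 0 < n)
    (h : e 0 < n ∨ e 0 < 2 * g) :
    MvPowerSeries.coeff e (principalSpecialization (primitive (Omega a g n))) = 0 := by
  change (if e 1 = 0 then _ else _) = _
  split_ifs
  · refine Finset.sum_eq_zero fun b hb => ?_
    rw [Finset.mem_finsuppAntidiag] at hb
    refine coeff_primitive_Omega_eq_zero a g n b hn ?_
    rcases h with h | h
    · left
      by_contra! hne
      have h1 : ∑ _j : Fin n, 1 ≤ ∑ j, b j :=
        Finset.sum_le_sum fun j _ => Nat.one_le_iff_ne_zero.mpr (hne j)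
      have h2 : ∑ j, b j = e 0 := hb.1
      simp at h1
      omega
    · right
      have h2 : ∑ j, b j = e 0 := hb.1
      omega
  · rfl

lemma finite_support_waveTerm (a : ℕ) (e : Fin 2 →₀ ℕ) :
    (Function.support fun p : ℕ × ℕ+ =>
      MvPowerSeries.coeff e (waveTerm a p.1 p.2)).Finite := by
  have hfin : ((fun p : ℕ × ℕ+ => (p.1, (p.2 : ℕ))) ⁻¹'
      (Set.Iic (e 0 + 1) ×ˢ Set.Iic (e 0 + 1))).Finite := by
    refine Set.Finite.preimage (fun p _ q _ h => ?_)
      ((Set.finite_Iic _).prod (Set.finite_Iic _))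
    simp only [Prod.mk.injEq] at h
    exact Prod.ext h.1 (PNat.coe_injective h.2)
  refine hfin.subset fun p hp => ?_
  by_contra hout
  refine hp ?_
  have hlt : e 0 + 1 < p.1 ∨ e 0 + 1 < (p.2 : ℕ) := by
    by_contra! hle
    exact hout ⟨hle.1, hle.2⟩
  have hne : ¬ (p.1 = 0 ∧ (p.2 : ℕ) = 1) := by omega
  have hz : MvPowerSeries.coeff e (freeEnergy a p.1 p.2) = 0 := by
    rw [freeEnergy, if_neg hne, zero_add]
    exact coeff_principalSpecialization_eq_zero a _ _ e p.2.pos (by omega)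
  change MvPowerSeries.coeff e (waveTerm a p.1 p.2) = 0
  rw [waveTerm, MvPowerSeries.coeff_smul, MvPowerSeries.coeff_map, hz, map_zero, mul_zero]

lemma constantCoeff_waveExponent (a : ℕ) :
    MvPowerSeries.constantCoeff (waveExponent a) = 0 := by
  rw [← MvPowerSeries.coeff_zero_eq_constantCoeff_apply]
  change (∑ᶠ p : ℕ × ℕ+, MvPowerSeries.coeff 0 (waveTerm a p.1 p.2)) = 0
  refine (finsum_congr fun p => ?_).trans (finsum_zero (α := ℕ × ℕ+))
  have hz : MvPowerSeries.coeff 0 (freeEnergy a p.1 p.2) = 0 := by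
    rw [freeEnergy, map_add, coeff_principalSpecialization_eq_zero a _ _ 0 p.2.pos
      (Or.inl (by simp)), add_zero]
    split_ifs
    · simp [logx]
    · rfl
  rw [waveTerm, MvPowerSeries.coeff_smul, MvPowerSeries.coeff_map, hz, map_zero, mul_zero]

end Hypermap

end

open Finset

noncomputable section

namespace Hypermap

/-! ### Multiplicative weights on permutations -/

section CycleWeight

variable {α β S : Type*}

lemma subtypeCongr_eq_mul (p : α → Prop) [DecidablePred p] (s : Equiv.Perm {x // p x})
    (t : Equiv.Perm {x // ¬p x}) :
    s.subtypeCongr t = Equiv.Perm.ofSubtype s * Equiv.Perm.ofSubtype t := by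
  ext x
  by_cases h : p x
  · rw [Equiv.Perm.subtypeCongr.left_apply _ _ h, Equiv.Perm.mul_apply,
      Equiv.Perm.ofSubtype_apply_of_not_mem t (not_not.2 h), Equiv.Perm.ofSubtype_apply_of_mem s h]
  · rw [Equiv.Perm.subtypeCongr.right_apply _ _ h, Equiv.Perm.mul_apply,
      Equiv.Perm.ofSubtype_apply_of_mem t h, Equiv.Perm.ofSubtype_apply_of_not_mem s (t ⟨x, h⟩).2]

lemma disjoint_ofSubtype (p : α → Prop) [DecidablePred p] (s : Equiv.Perm {x // p x})
    (t : Equiv.Perm {x // ¬p x}) :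
    (Equiv.Perm.ofSubtype s).Disjoint (Equiv.Perm.ofSubtype t) := by
  intro x
  by_cases h : p x
  · exact Or.inr (Equiv.Perm.ofSubtype_apply_of_not_mem t (not_not.2 h))
  · exact Or.inl (Equiv.Perm.ofSubtype_apply_of_not_mem s h)

variable [Fintype α] [DecidableEq α] [Fintype β] [DecidableEq β] [CommRing S]

/-- The product of `f` over the lengths of all cycles, fixed points included. -/
def cycleWeight (f : ℕ → S) (s : Equiv.Perm α) : S := (s.partition.parts.map f).prod

lemma cycleWeight_eq (f : ℕ → S) (s : Equiv.Perm α) :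
    cycleWeight f s = (s.cycleType.map f).prod * f 1 ^ (Fintype.card α - #s.support) := by
  simp [cycleWeight, Equiv.Perm.parts_partition]

lemma cycleType_permCongr (e : α ≃ β) (s : Equiv.Perm α) :
    (e.permCongr s).cycleType = s.cycleType := by
  have h : e.permCongr s =
      s.extendDomain (e.trans (Equiv.subtypeUnivEquiv (p := fun _ : β => True)
        fun _ => trivial).symm) := by
    ext x
    rw [Equiv.Perm.extendDomain_apply_subtype _ _ trivial]
    simp [Equiv.permCongr_apply, Equiv.subtypeUnivEquiv]
  rw [h, Equiv.Perm.cycleType_extendDomain]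

lemma cycleWeight_permCongr (f : ℕ → S) (e : α ≃ β) (s : Equiv.Perm α) :
    cycleWeight f (e.permCongr s) = cycleWeight f s := by
  rw [cycleWeight_eq, cycleWeight_eq, ← Equiv.Perm.sum_cycleType, ← Equiv.Perm.sum_cycleType,
    cycleType_permCongr, Fintype.card_congr e]

lemma cycleWeight_subtypeCongr (f : ℕ → S) (p : α → Prop) [DecidablePred p]
    (s : Equiv.Perm {x // p x}) (t : Equiv.Perm {x // ¬p x}) :
    cycleWeight f (s.subtypeCongr t) = cycleWeight f s * cycleWeight f t := by
  have hc : (s.subtypeCongr t).cycleType = s.cycleType + t.cycleType := by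
    rw [subtypeCongr_eq_mul, (disjoint_ofSubtype p s t).cycleType_mul,
      Equiv.Perm.cycleType_ofSubtype, Equiv.Perm.cycleType_ofSubtype]
  have hs := s.sum_cycleType_le
  have ht := t.sum_cycleType_le
  have hcard : Fintype.card α = Fintype.card {x // p x} + Fintype.card {x // ¬p x} := by
    rw [← Fintype.card_sum, Fintype.card_congr (Equiv.sumCompl p)]
  rw [cycleWeight_eq, cycleWeight_eq, cycleWeight_eq, ← Equiv.Perm.sum_cycleType,
    ← Equiv.Perm.sum_cycleType, ← Equiv.Perm.sum_cycleType, hc, hcard, Multiset.map_add,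
    Multiset.prod_add, Multiset.sum_add, ← tsub_add_tsub_comm hs ht, pow_add]
  ring

end CycleWeight

/-! ### Transitive tuples of permutations and the exponential formula -/

section Transitive

variable {ι α β S : Type*}

/-- `T` is stable under all permutations of the tuple `s`. -/
def IsStable (s : ι → Equiv.Perm α) (T : Set α) : Prop := ∀ i, ∀ x ∈ T, s i x ∈ T

/-- The tuple `s` has no stable subset besides `∅` and the whole set. -/
def IsTransitive (s : ι → Equiv.Perm α) : Prop :=
  ∀ T : Set α, IsStable s T → T.Nonempty → T = Set.univ

lemma IsStable.apply_mem_iff [Finite α] {s : ι → Equiv.Perm α} {T : Set α} (h : IsStable s T)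
    (i : ι) (x : α) : s i x ∈ T ↔ x ∈ T := by
  refine ⟨fun hx => ?_, h i x⟩
  have := Equiv.Perm.perm_symm_mapsTo_of_mapsTo (s i) (s := T) (fun y hy => h i y hy) hx
  simpa using this

lemma IsStable.compl [Finite α] {s : ι → Equiv.Perm α} {T : Set α} (h : IsStable s T) :
    IsStable s Tᶜ := fun i x hx hx' => hx ((h.apply_mem_iff i x).1 hx')

/-- The smallest stable set containing `x`. -/
def stableHull (s : ι → Equiv.Perm α) (x : α) : Set α :=
  {y | ∀ T, IsStable s T → x ∈ T → y ∈ T}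

lemma mem_stableHull (s : ι → Equiv.Perm α) (x : α) : x ∈ stableHull s x := fun _ _ h => h

lemma isStable_stableHull (s : ι → Equiv.Perm α) (x : α) : IsStable s (stableHull s x) :=
  fun i y hy T hT hx => hT i y (hy T hT hx)

lemma stableHull_subset {s : ι → Equiv.Perm α} {x : α} {T : Set α} (hT : IsStable s T)
    (hx : x ∈ T) : stableHull s x ⊆ T := fun _ hy => hy T hT hx

lemma isTransitive_permCongr (e : α ≃ β) (s : ι → Equiv.Perm α) :
    IsTransitive (fun i => e.permCongr (s i)) ↔ IsTransitive s := by
  constructor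
  · intro h T hT hne
    have := h (e '' T) ?_ (hne.image e)
    · rw [← Set.preimage_image_eq T e.injective, this, Set.preimage_univ]
    · rintro i _ ⟨x, hx, rfl⟩
      exact ⟨s i x, hT i x hx, by simp [Equiv.permCongr_apply]⟩
  · intro h T hT hne
    have := h (e ⁻¹' T) ?_ (hne.preimage e.surjective)
    · rw [← Set.image_preimage_eq T e.surjective, this, Set.image_univ, e.range_eq_univ]
    · intro i x hx
      simpa [Equiv.permCongr_apply] using hT i (e x) hx

variable [Fintype ι] [Fintype α] [DecidableEq α] [Fintype β] [DecidableEq β] [CommRing S]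

/-- The weight of a tuple of permutations. -/
def tupleWeight (f : ι → ℕ → S) (s : ι → Equiv.Perm α) : S := ∏ i, cycleWeight (f i) (s i)

variable [DecidableEq ι]

open Classical in
/-- The weighted number of tuples of permutations of `α`. -/
def totalSum (f : ι → ℕ → S) (α : Type*) [Fintype α] [DecidableEq α] : S :=
  ∑ s : ι → Equiv.Perm α, tupleWeight f s

open Classical in
/-- The weighted number of transitive tuples of permutations of `α`. -/
def transitiveSum (f : ι → ℕ → S) (α : Type*) [Fintype α] [DecidableEq α] : S :=
  ∑ s : ι → Equiv.Perm α with IsTransitive s, tupleWeight f s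

lemma totalSum_congr (f : ι → ℕ → S) (e : α ≃ β) : totalSum f α = totalSum f β :=
  Fintype.sum_equiv (Equiv.piCongrRight fun _ => e.permCongr) _ _ fun s => by
    simp [tupleWeight, cycleWeight_permCongr]

lemma transitiveSum_congr (f : ι → ℕ → S) (e : α ≃ β) :
    transitiveSum f α = transitiveSum f β := by
  classical
  refine Finset.sum_equiv (Equiv.piCongrRight fun _ => e.permCongr) (fun s => ?_) fun s _ => ?_
  · simp only [mem_filter, mem_univ, true_and]
    exact (isTransitive_permCongr e s).symm
  · simp [tupleWeight, cycleWeight_permCongr]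

lemma totalSum_eq_prod (f : ι → ℕ → S) :
    totalSum f α = ∏ i, ∑ s : Equiv.Perm α, cycleWeight (f i) s := by
  classical
  rw [Finset.prod_univ_sum, Fintype.piFinset_univ]
  rfl

open Classical in
lemma sum_stableHull_eq (f : ι → ℕ → S) (x : α) (T : Finset α) (hx : x ∉ T) :
    ∑ s : ι → Equiv.Perm α with (stableHull s x).toFinsetᶜ = T, tupleWeight f s =
      totalSum f {y // y ∈ T} * transitiveSum f {y // y ∉ T} := by
  rw [totalSum, transitiveSum, Finset.sum_mul_sum, ← Finset.sum_product']
  symm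
  refine Finset.sum_bij (fun q _ i => (q.1 i).subtypeCongr (q.2 i)) ?_ ?_ ?_ ?_
  · rintro ⟨a, b⟩ hq
    simp only [mem_product, mem_univ, mem_filter, true_and] at hq
    simp only [mem_filter, mem_univ, true_and]
    set s : ι → Equiv.Perm α := fun i => (a i).subtypeCongr (b i) with hs
    have hst : IsStable s {y | y ∉ T} := by
      intro i y hy
      rw [hs, Set.mem_ofPred_eq, Equiv.Perm.subtypeCongr.right_apply _ _ hy]
      exact (b i ⟨y, hy⟩).2
    have hsub := stableHull_subset hst (x := x) hx
    have huniv := hq (Subtype.val ⁻¹' stableHull s x) (fun i y hy => by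
      have := isStable_stableHull s x i y.1 hy
      rwa [hs, Equiv.Perm.subtypeCongr.right_apply_subtype] at this)
      ⟨⟨x, hx⟩, mem_stableHull s x⟩
    ext y
    simp only [mem_compl, Set.mem_toFinset]
    constructor
    · intro hy
      by_contra hyT
      exact hy ((Set.ext_iff.1 huniv ⟨y, hyT⟩).2 trivial)
    · intro hy hy'
      exact hsub hy' hy
  · rintro ⟨a, b⟩ - ⟨a', b'⟩ - h
    have h' : ∀ i, (a i, b i) = (a' i, b' i) := fun i =>
      Equiv.Perm.subtypeCongrHom_injective (fun y => y ∈ T) (congrFun h i)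
    refine Prod.ext (funext fun i => (Prod.ext_iff.1 (h' i)).1)
      (funext fun i => (Prod.ext_iff.1 (h' i)).2)
  · intro s hs
    simp only [mem_filter, mem_univ, true_and] at hs
    have hT : ∀ y, y ∉ T ↔ y ∈ stableHull s x := fun y => by simp [← hs]
    have hst := isStable_stableHull s x
    have h1 : ∀ i y, s i y ∉ T ↔ y ∉ T := fun i y => by
      rw [hT, hT, hst.apply_mem_iff]
    refine ⟨(fun i => (s i).subtypePerm fun y => not_iff_not.1 (h1 i y),
      fun i => (s i).subtypePerm (h1 i)), ?_, ?_⟩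
    · simp only [mem_product, mem_univ, mem_filter, true_and]
      intro U hU hne
      have hmem : ∀ y : {y // y ∉ T}, y ∈ U → stableHull s y.1 ⊆ Subtype.val '' U := by
        intro y hy
        refine stableHull_subset ?_ ⟨y, hy, rfl⟩
        rintro i _ ⟨z, hz, rfl⟩
        exact ⟨_, hU i z hz, rfl⟩
      obtain ⟨y, hy⟩ := hne
      have hst' : IsStable s (Subtype.val '' U) := by
        rintro i _ ⟨z, hz, rfl⟩
        exact ⟨_, hU i z hz, rfl⟩
      have hxU : x ∈ Subtype.val '' U := by
        by_contra hxU
        exact (hT y.1).1 y.2 _ hst'.compl hxU ⟨y, hy, rfl⟩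
      rw [Set.eq_univ_iff_forall]
      intro z
      obtain ⟨w, hw, hwz⟩ := (hT z.1).1 z.2 _ hst' hxU
      rwa [← Subtype.ext hwz]
    · funext i
      ext y
      by_cases hy : y ∈ T
      · rw [Equiv.Perm.subtypeCongr.left_apply _ _ hy]; rfl
      · rw [Equiv.Perm.subtypeCongr.right_apply _ _ hy]; rfl
  · rintro ⟨a, b⟩ -
    simp only [tupleWeight, cycleWeight_subtypeCongr, Finset.prod_mul_distrib]
    congr!

/-- The exponential formula, as a recurrence. -/
theorem totalSum_succ (f : ι → ℕ → S) (d : ℕ) :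
    totalSum f (Fin (d + 1)) = ∑ m ∈ range (d + 1),
      (d.choose m : S) * (totalSum f (Fin m) * transitiveSum f (Fin (d + 1 - m))) := by
  classical
  have h := Finset.sum_fiberwise_of_maps_to (s := (univ : Finset (ι → Equiv.Perm (Fin (d + 1)))))
    (t := (univ.erase 0).powerset) (g := fun s => (stableHull s 0).toFinsetᶜ)
    (fun s _ => by
      rw [mem_powerset, subset_erase]
      refine ⟨subset_univ _, ?_⟩
      simp [mem_stableHull]) (tupleWeight f)
  rw [totalSum, ← h]
  have h2 : ∀ T ∈ (univ.erase (0 : Fin (d + 1))).powerset,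
      ∑ s : ι → Equiv.Perm (Fin (d + 1)) with (stableHull s 0).toFinsetᶜ = T, tupleWeight f s =
      (fun m => totalSum f (Fin m) * transitiveSum f (Fin (d + 1 - m))) #T := by
    intro T hT
    rw [sum_stableHull_eq f 0 T (fun h0 => by simpa using mem_powerset.1 hT h0)]
    congr 1
    · exact totalSum_congr f (Fintype.equivFinOfCardEq (by simp))
    · exact transitiveSum_congr f (Fintype.equivFinOfCardEq (by
        rw [Fintype.card_subtype_compl]; simp))
  refine (Finset.sum_congr rfl h2).trans ((Finset.sum_powerset_apply_card
    (fun m => totalSum f (Fin m) * transitiveSum f (Fin (d + 1 - m)))).trans ?_)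
  simp [nsmul_eq_mul]

end Transitive

/-! ### Counting cycles -/

section CountCycles

variable {α S : Type*} [Fintype α] [DecidableEq α] [CommRing S]

/-- The number of cycles of a permutation is the number of its orbits. -/
lemma card_parts_partition (s : Equiv.Perm α) :
    s.partition.parts.card = Nat.card (Quotient (Equiv.Perm.SameCycle.setoid s)) := by
  classical
  let F : α → s.cycleFactorsFinset ⊕ {x // x ∉ s.support} := fun x =>
    if h : x ∈ s.support then Sum.inl ⟨s.cycleOf x, Equiv.Perm.cycleOf_mem_cycleFactorsFinset_iff.2 h⟩
    else Sum.inr ⟨x, h⟩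
  have hF : ∀ x y, F x = F y ↔ s.SameCycle x y := by
    intro x y
    by_cases hx : x ∈ s.support <;> by_cases hy : y ∈ s.support
    · simp only [F, dif_pos hx, dif_pos hy, Sum.inl.injEq, Subtype.mk.injEq]
      exact (Equiv.Perm.sameCycle_iff_cycleOf_eq_of_mem_support hx hy).symm
    · simp only [F, dif_pos hx, dif_neg hy, reduceCtorEq, false_iff]
      intro h
      exact hy (h.mem_support_iff.1 hx)
    · simp only [F, dif_neg hx, dif_pos hy, reduceCtorEq, false_iff]
      intro h
      exact hx (h.mem_support_iff.2 hy)
    · simp only [F, dif_neg hx, dif_neg hy, Sum.inr.injEq, Subtype.mk.injEq]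
      refine ⟨fun h => h ▸ Equiv.Perm.SameCycle.refl _ _, fun h => ?_⟩
      exact h.eq_of_left (Equiv.Perm.notMem_support.1 hx)
  let G : Quotient (Equiv.Perm.SameCycle.setoid s) → s.cycleFactorsFinset ⊕ {x // x ∉ s.support} :=
    Quotient.lift F fun x y h => (hF x y).2 h
  have hG : Function.Bijective G := by
    constructor
    · rintro ⟨x⟩ ⟨y⟩ h
      exact Quotient.sound ((hF x y).1 h)
    · rintro (⟨c, hc⟩ | ⟨x, hx⟩)
      · obtain ⟨x, hx⟩ := (Equiv.Perm.mem_cycleFactorsFinset_iff.1 hc).1.nonempty_support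
        refine ⟨Quotient.mk _ x, ?_⟩
        have hxs : x ∈ s.support := Equiv.Perm.mem_cycleFactorsFinset_support_le hc hx
        change F x = _
        simp only [F, dif_pos hxs, Sum.inl.injEq, Subtype.mk.injEq]
        exact (Equiv.Perm.cycle_is_cycleOf hx hc).symm
      · refine ⟨Quotient.mk _ x, ?_⟩
        change F x = _
        simp only [F, dif_neg hx]
  rw [Nat.card_congr (Equiv.ofBijective G hG), Nat.card_sum, Nat.card_eq_fintype_card,
    Nat.card_eq_fintype_card, Fintype.card_subtype_compl, Fintype.card_coe, Fintype.card_coe,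
    Equiv.Perm.parts_partition, Multiset.card_add, Multiset.card_replicate,
    Equiv.Perm.cycleType_def, Multiset.card_map]
  rfl

lemma cycleWeight_const (c : S) (s : Equiv.Perm α) :
    cycleWeight (fun _ => c) s = c ^ s.partition.parts.card := by
  simp [cycleWeight]

lemma cycleWeight_mul (f g : ℕ → S) (s : Equiv.Perm α) :
    cycleWeight (fun k => f k * g k) s = cycleWeight f s * cycleWeight g s :=
  Multiset.prod_map_mul

lemma IsTransitive.parts_partition_eq [Nonempty α] {s : Equiv.Perm α}
    (h : IsTransitive fun _ : Unit => s) : s.partition.parts = {Fintype.card α} := by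
  have hc : s.partition.parts.card = 1 := by
    rw [card_parts_partition, Nat.card_eq_one_iff_unique]
    refine ⟨⟨?_⟩, ⟨Quotient.mk _ (Classical.arbitrary α)⟩⟩
    rintro ⟨x⟩ ⟨y⟩
    refine Quotient.sound ?_
    have := h {z | s.SameCycle x z} (fun _ z hz => Equiv.Perm.sameCycle_apply_right.2 hz)
      ⟨x, Equiv.Perm.SameCycle.refl _ _⟩
    exact (Set.ext_iff.1 this y).2 trivial
  obtain ⟨k, hk⟩ := Multiset.card_eq_one.1 hc
  have := s.partition.parts_sum
  rw [hk, Multiset.sum_singleton] at this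
  rw [hk, this]

lemma transitiveSum_unit (f : ℕ → S) (k : ℕ) :
    transitiveSum (fun _ : Unit => f) (Fin (k + 1)) =
      f (k + 1) * ((transitiveSum (fun _ : Unit => fun _ => (1 : ℤ)) (Fin (k + 1)) : ℤ) : S) := by
  classical
  rw [transitiveSum, transitiveSum, Int.cast_sum, Finset.mul_sum]
  refine Finset.sum_congr rfl fun s hs => ?_
  have h := IsTransitive.parts_partition_eq (s := s ()) (by simpa using hs)
  simp [tupleWeight, cycleWeight, h]

lemma totalSum_unit (f : ℕ → S) :
    totalSum (fun _ : Unit => f) α = ∑ s : Equiv.Perm α, cycleWeight f s := by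
  simp [totalSum_eq_prod]

lemma transitiveSum_unit_one (k : ℕ) :
    transitiveSum (fun _ : Unit => fun _ => (1 : ℤ)) (Fin (k + 1)) = k.factorial := by
  have htot : ∀ n, totalSum (fun _ : Unit => fun _ => (1 : ℤ)) (Fin n) = n.factorial := by
    intro n
    simp [totalSum_unit, cycleWeight, Fintype.card_perm]
  induction k using Nat.strong_induction_on with
  | _ k ih =>
    have h := totalSum_succ (fun _ : Unit => fun _ => (1 : ℤ)) k
    rw [Finset.sum_range_succ', htot] at h
    have h2 : ∀ m ∈ range k, ((k.choose (m + 1) : ℕ) : ℤ) *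
        (totalSum (fun _ : Unit => fun _ => (1 : ℤ)) (Fin (m + 1)) *
          transitiveSum (fun _ : Unit => fun _ => (1 : ℤ)) (Fin (k + 1 - (m + 1)))) =
        k.factorial := by
      intro m hm
      rw [mem_range] at hm
      obtain ⟨j, rfl⟩ : ∃ j, k = m + 1 + j := ⟨k - (m + 1), by omega⟩
      rw [htot, show m + 1 + j + 1 - (m + 1) = j + 1 by omega, ih j (by omega)]
      have := Nat.choose_mul_factorial_mul_factorial (n := m + 1 + j) (k := m + 1) (by omega)
      rw [Nat.add_sub_cancel_left] at this
      rw [← mul_assoc]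
      exact_mod_cast this
    rw [Finset.sum_congr rfl h2] at h
    simp [htot, Nat.factorial_succ] at h
    linarith

/-- The recurrence obtained by removing the cycle through a given point. -/
lemma sum_cycleWeight_succ (f : ℕ → S) (d : ℕ) :
    ∑ s : Equiv.Perm (Fin (d + 1)), cycleWeight f s = ∑ m ∈ range (d + 1),
      (d.descFactorial (d - m) : S) *
        (f (d + 1 - m) * ∑ s : Equiv.Perm (Fin m), cycleWeight f s) := by
  rw [← totalSum_unit, totalSum_succ]
  refine Finset.sum_congr rfl fun m hm => ?_
  have hm' : m ≤ d := Nat.lt_succ_iff.1 (mem_range.1 hm)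
  rw [totalSum_unit, show d + 1 - m = d - m + 1 by omega, transitiveSum_unit,
    transitiveSum_unit_one, Nat.descFactorial_eq_factorial_mul_choose, Nat.choose_symm hm']
  push_cast
  ring

lemma sum_cycleWeight_const_succ (c : S) (d : ℕ) :
    ∑ s : Equiv.Perm (Fin (d + 1)), cycleWeight (fun _ => c) s =
      (c + d) * ∑ s : Equiv.Perm (Fin d), cycleWeight (fun _ => c) s := by
  rw [sum_cycleWeight_succ, Finset.sum_range_succ]
  rcases d with _ | d
  · simp
  · rw [add_mul, add_comm]
    congr 1
    · simp
    · rw [sum_cycleWeight_succ, Finset.mul_sum]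
      refine Finset.sum_congr rfl fun m hm => ?_
      have hm' : m ≤ d := Nat.lt_succ_iff.1 (mem_range.1 hm)
      rw [show d + 1 - m = d - m + 1 by omega, Nat.succ_descFactorial_succ]
      push_cast
      ring

lemma sum_cycleWeight_const (c : S) (d : ℕ) :
    ∑ s : Equiv.Perm (Fin d), cycleWeight (fun _ => c) s = ∏ j ∈ range d, (c + j) := by
  induction d with
  | zero => simp [cycleWeight_eq]
  | succ d ih => rw [sum_cycleWeight_const_succ, ih, Finset.prod_range_succ, mul_comm]

lemma sum_cycleWeight_div_factorial [Algebra ℚ S] (f : ℕ → S) (d : ℕ) :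
    ((d + 1 : ℕ) : S) * (((d + 1).factorial : ℚ)⁻¹ •
        ∑ s : Equiv.Perm (Fin (d + 1)), cycleWeight f s) =
      ∑ m ∈ range (d + 1), f (d + 1 - m) * ((m.factorial : ℚ)⁻¹ •
        ∑ s : Equiv.Perm (Fin m), cycleWeight f s) := by
  rw [sum_cycleWeight_succ, Finset.smul_sum, Finset.mul_sum]
  refine Finset.sum_congr rfl fun m hm => ?_
  have hm' : m ≤ d := Nat.lt_succ_iff.1 (mem_range.1 hm)
  have hq : ((d + 1 : ℕ) : ℚ) * (((d + 1).factorial : ℚ)⁻¹ * (d.descFactorial (d - m) : ℚ)) =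
      (m.factorial : ℚ)⁻¹ := by
    have h := Nat.factorial_mul_descFactorial (n := d) (k := d - m) (by omega)
    rw [show d - (d - m) = m by omega] at h
    have h' : (m.factorial : ℚ) * (d.descFactorial (d - m) : ℚ) = d.factorial := by
      exact_mod_cast h
    have h1 : (m.factorial : ℚ) ≠ 0 := by positivity
    have h2 : (d.factorial : ℚ) ≠ 0 := by positivity
    have h3 : ((d : ℚ) + 1) ≠ 0 := by positivity
    rw [Nat.factorial_succ]
    push_cast
    field_simp
    linarith
  have hS := congrArg (algebraMap ℚ S) hq
  rw [map_mul, map_mul, map_natCast, map_natCast] at hS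
  rw [Algebra.smul_def, Algebra.smul_def, ← hS]
  ring

end CountCycles

/-! ### The genus of a transitive triple -/

section Genus

variable {α : Type*} [Fintype α] [DecidableEq α]

/-- The functions that are constant on the cycles of `s`. -/
def invariantFunctions (s : Equiv.Perm α) : Submodule ℝ (EuclideanSpace ℝ α) where
  carrier := {v | ∀ i, v (s i) = v i}
  add_mem' hv hw i := by simp [hv i, hw i]
  zero_mem' i := by simp
  smul_mem' c v hv i := by simp [hv i]

omit [Fintype α] [DecidableEq α] in
lemma mem_invariantFunctions {s : Equiv.Perm α} {v : EuclideanSpace ℝ α} :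
    v ∈ invariantFunctions s ↔ ∀ i, v (s i) = v i := Iff.rfl

omit [DecidableEq α] in
lemma apply_eq_of_sameCycle {s : Equiv.Perm α} {v : EuclideanSpace ℝ α}
    (hv : v ∈ invariantFunctions s) {i j : α} (h : s.SameCycle i j) : v i = v j := by
  obtain ⟨k, rfl⟩ := h.exists_nat_pow_eq
  induction k with
  | zero => simp
  | succ k ih =>
    rw [pow_succ', Equiv.Perm.mul_apply, mem_invariantFunctions.1 hv, ← ih ⟨k, by simp⟩]

lemma finrank_invariantFunctions (s : Equiv.Perm α) :
    Module.finrank ℝ (invariantFunctions s) = s.partition.parts.card := by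
  classical
  let e : invariantFunctions s ≃ₗ[ℝ] (Quotient (Equiv.Perm.SameCycle.setoid s) → ℝ) :=
    { toFun := fun v q => Quotient.lift (fun i => v.1 i)
        (fun i j h => apply_eq_of_sameCycle v.2 h) q
      invFun := fun w => ⟨WithLp.toLp 2 fun i => w (Quotient.mk _ i), fun i =>
        congrArg w (Quotient.sound (Equiv.Perm.sameCycle_apply_left.2
          (Equiv.Perm.SameCycle.refl _ _)))⟩
      map_add' := fun v w => by
        funext q
        induction q using Quotient.inductionOn
        rfl
      map_smul' := fun c v => by
        funext q
        induction q using Quotient.inductionOn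
        rfl
      left_inv := fun v => rfl
      right_inv := fun w => by
        funext q
        induction q using Quotient.inductionOn
        rfl }
  have : Fintype (Quotient (Equiv.Perm.SameCycle.setoid s)) := Fintype.ofFinite _
  rw [e.finrank_eq, Module.finrank_fintype_fun_eq_card, card_parts_partition,
    Nat.card_eq_fintype_card]

omit [Fintype α] [DecidableEq α] in
lemma IsTransitive.exists_smul_one [Nonempty α] {x y : Equiv.Perm α} (h : IsTransitive ![x, y])
    {v : EuclideanSpace ℝ α} (hx : v ∈ invariantFunctions x) (hy : v ∈ invariantFunctions y) :
    ∃ c : ℝ, c • (WithLp.toLp 2 fun _ => 1 : EuclideanSpace ℝ α) = v := by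
  obtain ⟨i⟩ := ‹Nonempty α›
  have := h {j | v j = v i} (fun k j hj => by
    fin_cases k
    · exact (hx j).trans hj
    · exact (hy j).trans hj) ⟨i, rfl⟩
  refine ⟨v i, ?_⟩
  ext j
  have hj : v j = v i := (Set.ext_iff.1 this j).2 trivial
  simp [hj]

/-- The map `v ↦ v ∘ x - v`. -/
def subMap (x : Equiv.Perm α) : EuclideanSpace ℝ α →ₗ[ℝ] EuclideanSpace ℝ α where
  toFun v := WithLp.toLp 2 fun i => v (x i) - v i
  map_add' v w := by
    ext i
    simp
    ring
  map_smul' c v := by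
    ext i
    simp
    ring

omit [DecidableEq α] in
lemma subMap_mem_orthogonal {x y : Equiv.Perm α} {v : EuclideanSpace ℝ α}
    (hv : v ∈ invariantFunctions (x * y)) :
    subMap x v ∈ (invariantFunctions x ⊔ invariantFunctions y)ᗮ := by
  rw [← Submodule.inf_orthogonal, Submodule.mem_inf, Submodule.mem_orthogonal,
    Submodule.mem_orthogonal]
  constructor
  · intro w hw
    have h := Equiv.sum_comp x fun i => v i * w i
    simp only [PiLp.inner_apply, subMap, LinearMap.coe_mk, AddHom.coe_mk, RCLike.inner_apply,
      conj_trivial, sub_mul, Finset.sum_sub_distrib, sub_eq_zero]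
    rw [← h]
    exact Finset.sum_congr rfl fun i _ => by rw [hw i]
  · intro w hw
    have h := Equiv.sum_comp y fun i => v (x i) * w i
    simp only [PiLp.inner_apply, subMap, LinearMap.coe_mk, AddHom.coe_mk, RCLike.inner_apply,
      conj_trivial, sub_mul, Finset.sum_sub_distrib, sub_eq_zero]
    rw [← h]
    refine Finset.sum_congr rfl fun i _ => ?_
    have := hv i
    rw [Equiv.Perm.mul_apply] at this
    rw [hw i, this]

/-- The Riemann–Hurwitz bound: a transitive pair of permutations has genus at least zero. -/
theorem IsTransitive.card_parts_le [Nonempty α] {x y : Equiv.Perm α}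
    (h : IsTransitive ![x, y]) :
    x.partition.parts.card + y.partition.parts.card + (x * y).partition.parts.card ≤
      Fintype.card α + 2 := by
  have hone : ∀ s : Equiv.Perm α,
      (WithLp.toLp 2 fun _ => 1 : EuclideanSpace ℝ α) ∈ invariantFunctions s := fun s i => rfl
  have hinf : Module.finrank ℝ ↥(invariantFunctions x ⊓ invariantFunctions y) ≤ 1 := by
    refine finrank_le_one ⟨_, hone x, hone y⟩ fun w => ?_
    obtain ⟨c, hc⟩ := h.exists_smul_one w.2.1 w.2.2
    exact ⟨c, Subtype.ext hc⟩
  have hsup := Submodule.finrank_sup_add_finrank_inf_eq (invariantFunctions x)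
    (invariantFunctions y)
  have horth := Submodule.finrank_add_finrank_orthogonal
    (invariantFunctions x ⊔ invariantFunctions y)
  let φ := (subMap x).domRestrict (invariantFunctions (x * y))
  have hrank := φ.finrank_range_add_finrank_ker
  have hker : Module.finrank ℝ (LinearMap.ker φ) ≤ 1 := by
    refine finrank_le_one ⟨⟨_, hone (x * y)⟩, ?_⟩ fun w => ?_
    · rw [LinearMap.mem_ker]
      ext i
      simp [φ, subMap]
    · have hx : w.1.1 ∈ invariantFunctions x := by
        intro i
        have := congrArg (fun u : EuclideanSpace ℝ α => u i) (LinearMap.mem_ker.1 w.2)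
        simpa [φ, subMap, sub_eq_zero] using this
      have hy : w.1.1 ∈ invariantFunctions y := by
        intro i
        rw [← hx (y i)]
        exact w.1.2 i
      obtain ⟨c, hc⟩ := h.exists_smul_one hx hy
      exact ⟨c, Subtype.ext (Subtype.ext hc)⟩
  have hrange : Module.finrank ℝ (LinearMap.range φ) ≤
      Module.finrank ℝ ↥(invariantFunctions x ⊔ invariantFunctions y)ᗮ := by
    refine Submodule.finrank_mono ?_
    rintro _ ⟨v, rfl⟩
    exact subMap_mem_orthogonal v.2
  rw [finrank_euclideanSpace] at horth
  rw [finrank_invariantFunctions] at hrank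
  rw [finrank_invariantFunctions, finrank_invariantFunctions] at hsup
  omega

lemma sign_eq_neg_one_pow (s : Equiv.Perm α) :
    (Equiv.Perm.sign s : ℤ) = (-1) ^ (Fintype.card α + s.partition.parts.card) := by
  have h := s.sum_cycleType_le
  rw [Equiv.Perm.sign_of_cycleType, Equiv.Perm.parts_partition, Multiset.card_add,
    Multiset.card_replicate, ← Equiv.Perm.sum_cycleType]
  push_cast
  rw [neg_one_pow_eq_pow_mod_two, neg_one_pow_eq_pow_mod_two (n := Fintype.card α + _)]
  congr 1
  omega

lemma card_parts_partition_inv (s : Equiv.Perm α) :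
    s⁻¹.partition.parts.card = s.partition.parts.card := by
  simp [Equiv.Perm.parts_partition]

lemma neg_one_pow_card_parts {x y z : Equiv.Perm α} (h : x * y * z = 1) :
    (-1 : ℤ) ^ y.partition.parts.card =
      (-1) ^ (Fintype.card α + x.partition.parts.card + z.partition.parts.card) := by
  have hs := congrArg (fun s => ((Equiv.Perm.sign s : ℤˣ) : ℤ)) h
  simp only [map_mul, Units.val_mul, sign_eq_neg_one_pow, map_one, Units.val_one] at hs
  rw [← pow_add, ← pow_add] at hs
  have he := (neg_one_pow_eq_one_iff_even (by norm_num : (-1 : ℤ) ≠ 1)).1 hs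
  rw [neg_one_pow_eq_pow_mod_two, neg_one_pow_eq_pow_mod_two (n := Fintype.card α + _ + _)]
  congr 1
  rw [Nat.even_iff] at he
  omega

lemma IsTransitive.exists_genus [Nonempty α] {x y z : Equiv.Perm α} (h : IsTransitive ![x, z])
    (hxyz : x * y * z = 1) :
    ∃ g, x.partition.parts.card + y.partition.parts.card + z.partition.parts.card + 2 * g =
      Fintype.card α + 2 := by
  have h' : IsTransitive ![z, x] := by
    intro T hT
    refine h T fun i v hv => ?_
    fin_cases i
    · exact hT 1 v hv
    · exact hT 0 v hv
  have hle := h'.card_parts_le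
  have hy : y = (z * x)⁻¹ := by
    rw [mul_inv_rev, eq_inv_mul_iff_mul_eq, eq_inv_iff_mul_eq_one, hxyz]
  have hpar := neg_one_pow_card_parts hxyz
  rw [neg_one_pow_eq_pow_mod_two, neg_one_pow_eq_pow_mod_two (n := Fintype.card α + _ + _)] at hpar
  have hc : y.partition.parts.card = (z * x).partition.parts.card := by
    rw [hy, card_parts_partition_inv]
  have hmod : y.partition.parts.card % 2 =
      (Fintype.card α + x.partition.parts.card + z.partition.parts.card) % 2 := by
    rcases Nat.mod_two_eq_zero_or_one y.partition.parts.card with h1 | h1 <;>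
    rcases Nat.mod_two_eq_zero_or_one
      (Fintype.card α + x.partition.parts.card + z.partition.parts.card) with h2 | h2 <;>
    simp [h1, h2] at hpar ⊢
  refine ⟨(Fintype.card α + 2 - (x.partition.parts.card + y.partition.parts.card +
    z.partition.parts.card)) / 2, ?_⟩
  omega

end Genus

/-! ### Counting hypermaps by triples of permutations -/

section Counting

/-- Orbit counting: weighting each orbit by the inverse order of a stabilizer. -/
lemma finsum_inv_card_stabilizer {G X : Type*} [Group G] [Finite G] [MulAction G X] [Finite X]
    (A : Set X) (hA : ∀ (g : G), ∀ x ∈ A, g • x ∈ A) :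
    ∑ᶠ o ∈ (Quotient.mk (MulAction.orbitRel G X)) '' A,
      (Nat.card (MulAction.stabilizer G (Quotient.out o)) : ℚ)⁻¹ =
      (A.ncard : ℚ) / Nat.card G := by
  classical
  have : Fintype X := Fintype.ofFinite X
  have himg : (Quotient.mk (MulAction.orbitRel G X)) '' A =
      ((A.toFinset.image (Quotient.mk (MulAction.orbitRel G X)) : Finset _) : Set _) := by simp
  rw [himg, finsum_mem_coe_finset, Set.ncard_eq_toFinset_card',
    Finset.card_eq_sum_card_image (Quotient.mk (MulAction.orbitRel G X)) A.toFinset, Nat.cast_sum,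
    Finset.sum_div]
  refine Finset.sum_congr rfl fun o ho => ?_
  obtain ⟨x, hx, rfl⟩ := Finset.mem_image.1 ho
  rw [Set.mem_toFinset] at hx
  set y := Quotient.out (Quotient.mk (MulAction.orbitRel G X) x) with hy
  have hyx : Quotient.mk (MulAction.orbitRel G X) y = Quotient.mk (MulAction.orbitRel G X) x :=
    Quotient.out_eq _
  have hfib : ((A.toFinset.filter fun z => Quotient.mk (MulAction.orbitRel G X) z =
      Quotient.mk (MulAction.orbitRel G X) x : Finset X) : Set X) = MulAction.orbit G y := by
    ext z
    simp only [Finset.coe_filter, Set.mem_toFinset, Set.mem_ofPred_eq]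
    rw [← hyx]
    constructor
    · rintro ⟨-, h⟩
      exact Quotient.exact h
    · intro h
      refine ⟨?_, Quotient.sound h⟩
      have hzx : MulAction.orbitRel G X z x := Quotient.exact ((Quotient.sound h).trans hyx)
      obtain ⟨g, rfl⟩ := hzx
      exact hA g x hx
  have hcard := (MulAction.stabilizer G y).card_mul_index
  rw [MulAction.index_stabilizer, ← hfib, Set.ncard_coe_finset] at hcard
  have h1 : (Nat.card (MulAction.stabilizer G y) : ℚ) ≠ 0 := by
    exact_mod_cast Nat.card_pos.ne'
  have h2 : (Nat.card G : ℚ) ≠ 0 := by exact_mod_cast Nat.card_pos.ne'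
  rw [inv_eq_one_div, div_eq_div_iff h1 h2, one_mul, mul_comm]
  exact_mod_cast hcard.symm

variable {d n : ℕ}

lemma LabelledHypermap.isConnected_iff (H : LabelledHypermap d n) :
    H.IsConnected ↔ IsTransitive ![H.s0, H.sinf] := by
  unfold LabelledHypermap.IsConnected
  constructor
  · intro h T hT ⟨x, hx⟩
    rw [Set.eq_univ_iff_forall]
    intro y
    obtain ⟨⟨g, hg⟩, hgy⟩ := h.exists_smul_eq x y
    have hmem : ∀ g ∈ Subgroup.closure ({H.s0, H.s1, H.sinf} : Set (Equiv.Perm (Fin d))),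
        ∀ z, g z ∈ T ↔ z ∈ T := by
      intro g hg
      induction hg using Subgroup.closure_induction with
      | mem g hg =>
        have h0 : ∀ z, H.s0 z ∈ T ↔ z ∈ T := hT.apply_mem_iff 0
        have hi : ∀ z, H.sinf z ∈ T ↔ z ∈ T := hT.apply_mem_iff 1
        rcases hg with rfl | rfl | rfl
        · exact h0
        · intro z
          obtain ⟨w, rfl⟩ := H.sinf.surjective z
          have hw : H.s0 (H.s1 (H.sinf w)) = w := congrArg (fun s => s w) H.mul_eq_one
          rw [← h0, hw, hi]
        · exact hi
      | one => simp
      | mul a b _ _ ha hb => intro z; rw [Equiv.Perm.mul_apply, ha, hb]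
      | inv a _ ha => intro z; rw [← ha]; simp
    rw [← hgy]
    exact (hmem g hg x).2 hx
  · intro h
    refine ⟨fun x y => ?_⟩
    have := h (MulAction.orbit
      (Subgroup.closure ({H.s0, H.s1, H.sinf} : Set (Equiv.Perm (Fin d)))) x) ?_
      ⟨x, MulAction.mem_orbit_self x⟩
    · exact (Set.ext_iff.1 this y).2 trivial
    · rintro i _ ⟨g, rfl⟩
      have hmem : (![H.s0, H.sinf] : Fin 2 → Equiv.Perm (Fin d)) i ∈
          Subgroup.closure ({H.s0, H.s1, H.sinf} : Set (Equiv.Perm (Fin d))) := by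
        refine Subgroup.subset_closure ?_
        fin_cases i <;> simp
      exact ⟨⟨_, hmem⟩ * g, by simp [mul_smul]⟩

lemma LabelledHypermap.card_cycleLengths_eq (H : LabelledHypermap d n) :
    (cycleLengths H.s1).card = n := by
  rw [cycleLengths, card_parts_partition]
  refine (Nat.card_congr (Equiv.ofBijective
    (Quotient.lift H.label fun i j h => (H.label_eq_iff i j).2 h) ⟨?_, fun k => ?_⟩)).trans
    (Nat.card_fin n)
  · rintro ⟨i⟩ ⟨j⟩ h
    exact Quotient.sound ((H.label_eq_iff i j).1 h)
  · obtain ⟨i, hi⟩ := H.label_surjective k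
    exact ⟨Quotient.mk _ i, hi⟩

lemma LabelledHypermap.sum_cycleLength (H : LabelledHypermap d n) :
    ∑ j, H.cycleLength j = d := by
  have := Finset.card_eq_sum_card_fiberwise (s := (univ : Finset (Fin d))) (t := univ)
    (f := H.label) (fun _ _ => mem_univ _)
  simpa [LabelledHypermap.cycleLength] using this.symm

lemma cycleLengths_conj (s τ : Equiv.Perm (Fin d)) :
    cycleLengths (τ * s * τ⁻¹) = cycleLengths s := by
  unfold cycleLengths
  rw [Equiv.Perm.partition_eq_of_isConj.1 (isConj_iff.2 ⟨τ, rfl⟩ : IsConj s (τ * s * τ⁻¹))]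

lemma smul_mem_hypermapsOfType (g : ℕ) (α : Multiset ℕ) (b : Fin n → ℕ)
    (τ : Equiv.Perm (Fin (∑ j, b j))) (H : LabelledHypermap (∑ j, b j) n)
    (hH : H ∈ hypermapsOfType g n α b) : τ • H ∈ hypermapsOfType g n α b := by
  obtain ⟨h1, h2, h3, h4⟩ := hH
  refine ⟨?_, ?_, ?_, fun j => ?_⟩
  · rw [LabelledHypermap.isConnected_iff] at h1 ⊢
    rw [← isTransitive_permCongr τ] at h1
    convert h1 using 1
    funext i
    fin_cases i <;> rfl
  · unfold LabelledHypermap.HasGenus at h2 ⊢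
    change (cycleLengths (τ * H.s0 * τ⁻¹)).card + (cycleLengths (τ * H.s1 * τ⁻¹)).card +
      (cycleLengths (τ * H.sinf * τ⁻¹)).card + 2 * g = _
    simpa only [cycleLengths_conj] using h2
  · change cycleLengths (τ * H.sinf * τ⁻¹) = α
    rw [cycleLengths_conj, h3]
  · rw [← h4 j]
    unfold LabelledHypermap.cycleLength
    refine Finset.card_bij' (fun i _ => τ⁻¹ i) (fun i _ => τ i) ?_ ?_ ?_ ?_
    · intro i hi
      simp only [mem_filter, mem_univ, true_and] at hi ⊢
      exact hi
    · intro i hi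
      simp only [mem_filter, mem_univ, true_and] at hi ⊢
      change H.label (τ⁻¹ (τ i)) = j
      simpa using hi
    · simp
    · simp

lemma weightedCount_eq (g : ℕ) (α : Multiset ℕ) (b : Fin n → ℕ) :
    weightedCount g n α b = ((hypermapsOfType g n α b).ncard : ℚ) / (∑ j, b j).factorial := by
  rw [weightedCount, finsum_inv_card_stabilizer _ (smul_mem_hypermapsOfType g α b),
    Nat.card_perm, Nat.card_fin]

/-- The number of labellings of the cycles of a permutation. -/
lemma card_labelledHypermap_fiber (x z : Equiv.Perm (Fin d)) :
    Nat.card {H : LabelledHypermap d n // H.s0 = x ∧ H.sinf = z} =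
      if (cycleLengths (z * x)⁻¹).card = n then n.factorial else 0 := by
  set y := (z * x)⁻¹ with hy
  have hxyz : x * y * z = 1 := by simp [hy]
  have hs1 : ∀ H : LabelledHypermap d n, H.s0 = x → H.sinf = z → H.s1 = y := by
    intro H h0 h1
    rw [hy, eq_inv_iff_mul_eq_one, ← h0, ← h1, ← mul_assoc,
      mul_eq_one_iff_eq_inv, mul_eq_one_iff_inv_eq.1 ((mul_assoc _ _ _).symm.trans H.mul_eq_one)]
  split_ifs with hn
  · rw [cycleLengths, card_parts_partition] at hn
    let e₀ : Quotient (Equiv.Perm.SameCycle.setoid y) ≃ Fin n := Finite.equivFinOfCardEq hn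
    let F : Equiv.Perm (Fin n) → {H : LabelledHypermap d n // H.s0 = x ∧ H.sinf = z} := fun π =>
      ⟨{ s0 := x
         s1 := y
         sinf := z
         mul_eq_one := hxyz
         label := fun i => π (e₀ (Quotient.mk _ i))
         label_surjective := π.surjective.comp (e₀.surjective.comp Quotient.mk_surjective)
         label_eq_iff := fun i j => by
           rw [π.injective.eq_iff, e₀.injective.eq_iff]
           exact Quotient.eq }, rfl, rfl⟩
    have hF : Function.Bijective F := by
      constructor
      · intro π π' h
        ext k : 1
        obtain ⟨q, rfl⟩ := e₀.surjective k
        obtain ⟨i, rfl⟩ := Quotient.mk_surjective q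
        exact congrFun (congrArg (fun H => H.1.label) h) i
      · rintro ⟨H, h0, h1⟩
        have h2 := hs1 H h0 h1
        let G : Quotient (Equiv.Perm.SameCycle.setoid y) → Fin n :=
          Quotient.lift H.label fun i j h => (H.label_eq_iff i j).2 (h2 ▸ h)
        have hG : Function.Bijective G := by
          constructor
          · rintro ⟨i⟩ ⟨j⟩ h
            exact Quotient.sound (h2 ▸ (H.label_eq_iff i j).1 h)
          · intro k
            obtain ⟨i, hi⟩ := H.label_surjective k
            exact ⟨Quotient.mk _ i, hi⟩
        refine ⟨e₀.symm.trans (Equiv.ofBijective G hG), Subtype.ext ?_⟩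
        refine LabelledHypermap.ext h0.symm h2.symm h1.symm ?_
        funext i
        simp [F, G]
    rw [← Nat.card_congr (Equiv.ofBijective F hF), Nat.card_perm, Nat.card_fin]
  · have : IsEmpty {H : LabelledHypermap d n // H.s0 = x ∧ H.sinf = z} :=
      ⟨fun H => hn (by rw [← hs1 H.1 H.2.1 H.2.2, H.1.card_cycleLengths_eq])⟩
    exact Nat.card_of_isEmpty

end Counting

/-! ### Exponentials of formal series -/

section Exponential

variable {σ S : Type*} [CommRing S]

lemma coeff_pow_eq_zero_of_degree_lt {g : MvPowerSeries σ S}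
    (hg : MvPowerSeries.constantCoeff g = 0) {e : σ →₀ ℕ} {m : ℕ} (h : e.degree < m) :
    MvPowerSeries.coeff e (g ^ m) = 0 := by
  refine MvPowerSeries.coeff_of_lt_order (lt_of_lt_of_le ?_
    (MvPowerSeries.le_order_pow_of_constantCoeff_eq_zero m hg))
  exact_mod_cast h

/-- The chain rule for the substitution of a multivariate series into a univariate one. -/
lemma pderiv_subst (i : σ) {g : MvPowerSeries σ S} (hg : MvPowerSeries.constantCoeff g = 0)
    (f : PowerSeries S) :
    MvPowerSeries.pderiv S i (f.subst g) =
      (PowerSeries.derivative S f).subst g * MvPowerSeries.pderiv S i g := by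
  classical
  have hs : PowerSeries.HasSubst g := PowerSeries.HasSubst.of_constantCoeff_zero hg
  have hpoly : ∀ p : Polynomial S, MvPowerSeries.pderiv S i ((p : PowerSeries S).subst g) =
      (PowerSeries.derivative S (p : PowerSeries S)).subst g * MvPowerSeries.pderiv S i g := by
    intro p
    simp [PowerSeries.subst_coe hs, PowerSeries.derivative_coe,
      Derivation.comp_aeval_eq (a := g) (MvPowerSeries.pderiv S i) p, smul_eq_mul]
  ext n
  set m := n.degree + 1 with hm
  have hdeg : (n + Finsupp.single i 1).degree = m := by simp [hm]
  have htrunc : MvPowerSeries.coeff (n + Finsupp.single i 1) (f.subst g) =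
      MvPowerSeries.coeff (n + Finsupp.single i 1)
        (((f.trunc (m + 1) : Polynomial S) : PowerSeries S).subst g) := by
    rw [PowerSeries.coeff_subst hs, PowerSeries.coeff_subst hs]
    refine finsum_congr fun k => ?_
    rcases lt_or_ge m k with hk | hk
    · rw [coeff_pow_eq_zero_of_degree_lt hg (hdeg ▸ hk), smul_zero, smul_zero]
    · rw [PowerSeries.coeff_coe_trunc_of_lt (by omega)]
  rw [MvPowerSeries.coeff_pderiv, htrunc, ← MvPowerSeries.coeff_pderiv, hpoly,
    MvPowerSeries.coeff_mul, MvPowerSeries.coeff_mul]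
  refine Finset.sum_congr rfl fun ⟨p, q⟩ hpq => ?_
  congr 1
  rw [PowerSeries.coeff_subst hs, PowerSeries.coeff_subst hs]
  refine finsum_congr fun k => ?_
  have hp : p.degree < m := by
    have hn : p + q = n := mem_antidiagonal.1 hpq
    rw [hm, ← hn, map_add]
    omega
  rcases lt_or_ge p.degree k with hk | hk
  · rw [coeff_pow_eq_zero_of_degree_lt hg hk, smul_zero, smul_zero]
  · rw [PowerSeries.coeff_derivative, PowerSeries.coeff_derivative,
      PowerSeries.coeff_coe_trunc_of_lt (by omega)]

variable [Algebra ℚ S]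

lemma pderiv_exp_subst (i : σ) {g : MvPowerSeries σ S}
    (hg : MvPowerSeries.constantCoeff g = 0) :
    MvPowerSeries.pderiv S i ((PowerSeries.exp S).subst g) =
      (PowerSeries.exp S).subst g * MvPowerSeries.pderiv S i g := by
  rw [pderiv_subst i hg, PowerSeries.derivative_exp]

lemma constantCoeff_exp_subst {g : MvPowerSeries σ S}
    (hg : MvPowerSeries.constantCoeff g = 0) :
    MvPowerSeries.constantCoeff ((PowerSeries.exp S).subst g) = 1 := by
  rw [PowerSeries.constantCoeff_subst (PowerSeries.HasSubst.of_constantCoeff_zero hg),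
    finsum_eq_single _ 0 fun k hk => by simp [hg, hk]]
  simp

/-- A series with constant term one is the exponential of `g` when its logarithmic derivatives are
the derivatives of `g`. -/
lemma eq_exp_subst [IsAddTorsionFree S] {f g : MvPowerSeries σ S}
    (hg : MvPowerSeries.constantCoeff g = 0) (hf : MvPowerSeries.constantCoeff f = 1)
    (hd : ∀ i, MvPowerSeries.pderiv S i f = f * MvPowerSeries.pderiv S i g) :
    f = (PowerSeries.exp S).subst g := by
  have hneg : MvPowerSeries.constantCoeff (-g) = 0 := by simp [hg]
  have key : ∀ h : MvPowerSeries σ S, MvPowerSeries.constantCoeff h = 1 →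
      (∀ i, MvPowerSeries.pderiv S i h = h * MvPowerSeries.pderiv S i g) →
      h * (PowerSeries.exp S).subst (-g) = 1 := by
    intro h h1 h2
    refine MvPowerSeries.pderiv.ext (fun i => ?_) ?_
    · rw [Derivation.leibniz, pderiv_exp_subst i hneg, h2, Derivation.map_one_eq_zero, map_neg]
      simp only [smul_eq_mul]
      ring
    · rw [map_mul, h1, constantCoeff_exp_subst hneg, map_one, one_mul]
  have h1 := key f hf hd
  have h2 := key _ (constantCoeff_exp_subst hg) fun i => pderiv_exp_subst i hg
  calc f = f * ((PowerSeries.exp S).subst g * (PowerSeries.exp S).subst (-g)) := by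
        rw [h2, mul_one]
    _ = (PowerSeries.exp S).subst g * (f * (PowerSeries.exp S).subst (-g)) := by ring
    _ = _ := by rw [h1, mul_one]

end Exponential

/-! ### The coefficients of the exponent of the wave function -/

section Coefficients

variable {d n : ℕ}

instance : Fintype (LabelledHypermap d n) := Fintype.ofFinite _

/-- The parameter `t_i`, set to zero for `i > a`. -/
def truncatedParameter (a i : ℕ) : TRing := if i ≤ a then MvPolynomial.X i else 0

lemma sum_partition_parts_eq (a : ℕ) (s : Equiv.Perm (Fin d)) :
    ∑ p ∈ (univ : Finset d.Partition).filter (fun p => ∀ i ∈ p.parts, i ≤ a),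
      (if cycleLengths s = p.parts then (p.parts.map fun i => (MvPolynomial.X i : TRing)).prod
        else 0) = cycleWeight (truncatedParameter a) s := by
  let p₀ : d.Partition :=
    ⟨s.partition.parts, s.partition.parts_pos, s.partition.parts_sum.trans (Fintype.card_fin d)⟩
  have hp₀ : ∀ p : d.Partition, cycleLengths s = p.parts → p = p₀ := fun p hp =>
    Nat.Partition.ext hp.symm
  by_cases hs : ∀ i ∈ s.partition.parts, i ≤ a
  · rw [Finset.sum_eq_single p₀]
    · rw [if_pos (show cycleLengths s = p₀.parts from rfl), cycleWeight]
      refine congrArg Multiset.prod (Multiset.map_congr rfl fun i hi => ?_)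
      rw [truncatedParameter, if_pos (hs i hi)]
    · intro p _ hp
      rw [if_neg fun h => hp (hp₀ p h)]
    · intro h
      exact absurd (mem_filter.2 ⟨mem_univ p₀, hs⟩) h
  · rw [Finset.sum_eq_zero]
    · push Not at hs
      obtain ⟨i, hi, hia⟩ := hs
      refine (Multiset.prod_eq_zero (Multiset.mem_map.2 ⟨i, hi, ?_⟩)).symm
      rw [truncatedParameter, if_neg (by omega)]
    · intro p hp
      rw [if_neg]
      intro h
      exact hs fun i hi => (mem_filter.1 hp).2 i (h ▸ hi)

open Classical in
lemma countPoly_eq (a g : ℕ) (b : Fin n → ℕ) (hb : ∑ j, b j = d) :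
    countPoly a g n b = ((d.factorial : ℚ)⁻¹) •
      ∑ H : LabelledHypermap d n with
        (H.IsConnected ∧ H.HasGenus g) ∧ (∀ j, H.cycleLength j = b j),
        cycleWeight (truncatedParameter a) H.sinf := by
  subst hb
  simp_rw [← sum_partition_parts_eq a]
  rw [countPoly, Finset.sum_comm, Finset.smul_sum]
  refine Finset.sum_congr rfl fun p _ => ?_
  rw [← Finset.sum_filter, Finset.sum_const, weightedCount_eq, Finset.filter_filter,
    MvPolynomial.C_mul', div_eq_inv_mul, mul_smul, Nat.cast_smul_eq_nsmul]
  congr 2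
  rw [← Set.ncard_coe_finset]
  congr 1
  ext H
  simp only [hypermapsOfType, Set.mem_ofPred_eq, coe_filter, mem_univ, true_and]
  tauto

open Classical in
lemma sum_countPoly_eq (a g : ℕ) :
    ∑ b ∈ (univ : Finset (Fin n)).finsuppAntidiag d, countPoly a g n b =
      ((d.factorial : ℚ)⁻¹) • ∑ H : LabelledHypermap d n with H.IsConnected ∧ H.HasGenus g,
        cycleWeight (truncatedParameter a) H.sinf := by
  rw [← Finset.sum_fiberwise_of_maps_to
    (t := (univ : Finset (Fin n)).finsuppAntidiag d)
    (g := fun H : LabelledHypermap d n => Finsupp.equivFunOnFinite.symm H.cycleLength)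
    (fun H _ => by
      rw [mem_finsuppAntidiag]
      exact ⟨H.sum_cycleLength, subset_univ _⟩), Finset.smul_sum]
  refine Finset.sum_congr rfl fun b hb => ?_
  rw [countPoly_eq a g b (mem_finsuppAntidiag.1 hb).1, Finset.filter_filter]
  congr 2
  ext H
  simp only [mem_filter, mem_univ, true_and, DFunLike.ext_iff]
  rfl

/-- The number of cycles of the middle permutation of the triple determined by `s`. -/
def middleCard (s : Fin 2 → Equiv.Perm (Fin d)) : ℕ := (cycleLengths (s 1 * s 0)⁻¹).card

open Classical in
lemma sum_connected_eq (a g : ℕ) :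
    ∑ H : LabelledHypermap d n with H.IsConnected ∧ H.HasGenus g,
        cycleWeight (truncatedParameter a) H.sinf =
      ∑ s : Fin 2 → Equiv.Perm (Fin d) with IsTransitive s,
        if middleCard s = n ∧ (cycleLengths (s 0)).card + middleCard s +
            (cycleLengths (s 1)).card + 2 * g = d + 2 then
          (n.factorial : TRing) * cycleWeight (truncatedParameter a) (s 1) else 0 := by
  rw [← Finset.sum_fiberwise_of_maps_to
    (t := univ.filter fun s : Fin 2 → Equiv.Perm (Fin d) => IsTransitive s)
    (g := fun H : LabelledHypermap d n => ![H.s0, H.sinf])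
    (fun H hH => by
      simp only [mem_filter, mem_univ, true_and] at hH ⊢
      exact H.isConnected_iff.1 hH.1)]
  refine Finset.sum_congr rfl fun s hs => ?_
  rw [mem_filter] at hs
  have hH : ∀ H : LabelledHypermap d n, ![H.s0, H.sinf] = s ↔ H.s0 = s 0 ∧ H.sinf = s 1 := by
    intro H
    constructor
    · rintro rfl
      exact ⟨rfl, rfl⟩
    · rintro ⟨h0, h1⟩
      funext i
      fin_cases i
      · exact h0
      · exact h1
  have hs1 : ∀ H : LabelledHypermap d n, ![H.s0, H.sinf] = s → H.s1 = (s 1 * s 0)⁻¹ := by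
    intro H h
    obtain ⟨h0, h1⟩ := (hH H).1 h
    rw [← h0, ← h1, eq_inv_iff_mul_eq_one, ← mul_assoc, mul_eq_one_iff_eq_inv,
      mul_eq_one_iff_inv_eq.1 ((mul_assoc _ _ _).symm.trans H.mul_eq_one)]
  rw [Finset.filter_filter]
  by_cases hg : (cycleLengths (s 0)).card + middleCard s +
            (cycleLengths (s 1)).card + 2 * g = d + 2
  · have hfil : (univ.filter fun H : LabelledHypermap d n =>
        (H.IsConnected ∧ H.HasGenus g) ∧ ![H.s0, H.sinf] = s) =
        univ.filter fun H : LabelledHypermap d n => H.s0 = s 0 ∧ H.sinf = s 1 := by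
      ext H
      simp only [mem_filter, mem_univ, true_and, ← hH]
      refine ⟨fun h => h.2, fun h => ⟨⟨?_, ?_⟩, h⟩⟩
      · rw [H.isConnected_iff, h]
        exact hs.2
      · unfold LabelledHypermap.HasGenus
        rw [hs1 H h, ((hH H).1 h).1, ((hH H).1 h).2]
        exact hg
    have hconst : ∀ H ∈ univ.filter fun H : LabelledHypermap d n => H.s0 = s 0 ∧ H.sinf = s 1,
        cycleWeight (truncatedParameter a) H.sinf =
          cycleWeight (truncatedParameter a) (s 1) := by
      intro H h
      rw [(mem_filter.1 h).2.2]
    rw [hfil, Finset.sum_congr rfl hconst, Finset.sum_const, ← Fintype.card_subtype,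
      ← Nat.card_eq_fintype_card, card_labelledHypermap_fiber, nsmul_eq_mul]
    by_cases hn : middleCard s = n
    · rw [if_pos (by exact hn), if_pos ⟨hn, hg⟩]
    · rw [if_neg (by exact hn), if_neg fun h => hn h.1, Nat.cast_zero, zero_mul]
  · rw [if_neg fun h => hg h.2, Finset.sum_eq_zero]
    intro H h
    exfalso
    simp only [mem_filter, mem_univ, true_and] at h
    have := h.1.2
    unfold LabelledHypermap.HasGenus at this
    rw [hs1 H h.2, ((hH H).1 h.2).1, ((hH H).1 h.2).2] at this
    exact hg this

lemma countPoly_eq_zero (a g : ℕ) (b : Fin n → ℕ) (j : Fin n) (hj : b j = 0) :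
    countPoly a g n b = 0 := by
  classical
  rw [countPoly_eq a g b rfl]
  refine smul_eq_zero_of_right _ (Finset.sum_eq_zero fun H h => ?_)
  exfalso
  simp only [mem_filter, mem_univ, true_and] at h
  have h0 := h.2 j
  obtain ⟨i, hi⟩ := H.label_surjective j
  rw [hj, LabelledHypermap.cycleLength, Finset.card_eq_zero] at h0
  have : i ∈ (univ.filter fun i => H.label i = j) := by simp [hi]
  rw [h0] at this
  simp at this

lemma coeff_primitive_Omega (a g : ℕ) (b : Fin n →₀ ℕ) :
    MvPowerSeries.coeff b (primitive (Omega a g n)) = (-1) ^ n * countPoly a g n b := by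
  have hO : MvPowerSeries.coeff (b + Finsupp.equivFunOnFinite.symm fun _ => 1) (Omega a g n) =
      (∏ j, (b j : ℚ)) • countPoly a g n b := by
    change (if _ then _ else _) = _
    rw [if_pos (by simp)]
    simp
  change (∏ j, -((b j : ℚ)⁻¹)) • MvPowerSeries.coeff _ (Omega a g n) = _
  rw [hO, smul_smul, ← Finset.prod_mul_distrib]
  by_cases h : ∃ j, b j = 0
  · obtain ⟨j, hj⟩ := h
    rw [countPoly_eq_zero a g b j hj, smul_zero, mul_zero]
  · push Not at h
    have h1 : ∀ j, -((b j : ℚ)⁻¹) * b j = -1 := fun j => by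
      have : (b j : ℚ) ≠ 0 := by exact_mod_cast h j
      field_simp
    simp [h1, Algebra.smul_def]

open Classical in
lemma coeff_principalSpecialization_eq (a g : ℕ) (e : Fin 2 →₀ ℕ) :
    MvPowerSeries.coeff e (principalSpecialization (primitive (Omega a g n))) =
      if e 1 = 0 then (((e 0).factorial : ℚ)⁻¹ * n.factorial) •
        ∑ s : Fin 2 → Equiv.Perm (Fin (e 0)) with IsTransitive s,
          if middleCard s = n ∧ (cycleLengths (s 0)).card + middleCard s +
              (cycleLengths (s 1)).card + 2 * g = e 0 + 2 then
            (-1) ^ n * cycleWeight (truncatedParameter a) (s 1) else 0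
      else 0 := by
  change (if _ then _ else _) = _
  refine if_congr Iff.rfl ?_ rfl
  simp_rw [coeff_primitive_Omega]
  rw [← Finset.mul_sum, sum_countPoly_eq, sum_connected_eq, mul_smul, mul_smul_comm]
  congr 1
  rw [Finset.mul_sum, Finset.smul_sum]
  refine Finset.sum_congr rfl fun s _ => ?_
  split_ifs
  · rw [Nat.cast_smul_eq_nsmul, nsmul_eq_mul]
    ring
  · simp

end Coefficients

/-! ### The exponent as a sum over transitive pairs of permutations -/

section Exponent

lemma map_cycleWeight {α S S' : Type*} [Fintype α] [DecidableEq α] [CommRing S] [CommRing S']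
    (φ : S →+* S') (f : ℕ → S) (s : Equiv.Perm α) :
    φ (cycleWeight f s) = cycleWeight (fun i => φ (f i)) s := by
  simp [cycleWeight, map_multiset_prod, Multiset.map_map]

/-- The weight `-t_i / ħ` of a cycle of `sinf` of length `i`. -/
def poleWeight (a i : ℕ) : HRing :=
  -LaurentPolynomial.T (-1) * LaurentPolynomial.C (truncatedParameter a i)

/-- The weights of the cycles of a pair of permutations `(s0, sinf)`. -/
def pairWeight (a : ℕ) : Fin 2 → ℕ → HRing :=
  ![fun _ => -LaurentPolynomial.T (-1), poleWeight a]

lemma neg_T_pow (k : ℤ) (m : ℕ) :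
    (-LaurentPolynomial.T k : HRing) ^ m = (-1) ^ m * LaurentPolynomial.T (m * k) := by
  exact (neg_pow (LaurentPolynomial.T k : HRing) m).trans (by rw [LaurentPolynomial.T_pow])

lemma tupleWeight_pairWeight (a : ℕ) {d : ℕ} (s : Fin 2 → Equiv.Perm (Fin d)) {g n : ℕ}
    (hn : middleCard s = n) (hg : (cycleLengths (s 0)).card + middleCard s +
      (cycleLengths (s 1)).card + 2 * g = d + 2) :
    (-hbar) ^ d * tupleWeight (pairWeight a) s =
      LaurentPolynomial.T (2 * (g : ℤ) + (n : ℤ) - 2) *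
        LaurentPolynomial.C ((-1) ^ n * cycleWeight (truncatedParameter a) (s 1)) := by
  have hsign := neg_one_pow_card_parts (x := s 0) (y := (s 1 * s 0)⁻¹) (z := s 1) (by simp)
  change (-1 : ℤ) ^ middleCard s = (-1) ^ (Fintype.card (Fin d) + (cycleLengths (s 0)).card +
    (cycleLengths (s 1)).card) at hsign
  have hsign' := congrArg (fun k : ℤ => (k : HRing)) hsign
  simp only [Int.cast_pow, Int.cast_neg, Int.cast_one, Fintype.card_fin] at hsign'
  have hT : (LaurentPolynomial.T (2 * (g : ℤ) + (n : ℤ) - 2) : HRing) =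
      LaurentPolynomial.T (d * 1) * (LaurentPolynomial.T ((cycleLengths (s 0)).card * (-1)) *
        LaurentPolynomial.T ((cycleLengths (s 1)).card * (-1))) := by
    rw [← LaurentPolynomial.T_add, ← LaurentPolynomial.T_add]
    congr 1
    omega
  have h1 : cycleWeight (poleWeight a) (s 1) =
      (-LaurentPolynomial.T (-1)) ^ (cycleLengths (s 1)).card *
        LaurentPolynomial.C (cycleWeight (truncatedParameter a) (s 1)) := by
    rw [map_cycleWeight]
    exact (cycleWeight_mul (fun _ => -LaurentPolynomial.T (-1)) _ _).trans
      (by rw [cycleWeight_const]; rfl)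
  have h0 : cycleWeight (fun _ => (-LaurentPolynomial.T (-1) : HRing)) (s 0) =
      (-LaurentPolynomial.T (-1)) ^ (cycleLengths (s 0)).card := cycleWeight_const _ _
  rw [tupleWeight, Fin.prod_univ_two]
  simp only [pairWeight, Matrix.cons_val_zero, Matrix.cons_val_one]
  rw [h0, h1, hbar, neg_T_pow, neg_T_pow, neg_T_pow, hT, map_mul, map_pow, map_neg, map_one,
    ← hn, hsign', pow_add, pow_add]
  ring

/-- The part of the exponent of the wave function without `log x`, as a series in `x⁻¹`. -/
def exponentSeries (a : ℕ) : PowerSeries HRing := PowerSeries.mk fun d =>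
  if d = 0 then 0
  else ((d.factorial : ℚ)⁻¹) • ((-hbar) ^ d * transitiveSum (pairWeight a) (Fin d))

lemma coeff_subst_invx (f : PowerSeries HRing) (e : Fin 2 →₀ ℕ) :
    MvPowerSeries.coeff e (f.subst (invx : LogSeries HRing)) =
      if e 1 = 0 then PowerSeries.coeff (e 0) f else 0 := by
  rw [invx, PowerSeries.coeff_subst_single]
  refine if_congr ?_ rfl rfl
  constructor
  · intro h
    rw [h]
    simp
  · intro h
    ext i
    fin_cases i
    · simp
    · simpa using h

lemma finsum_coeff_waveTerm (a : ℕ) (e : Fin 2 →₀ ℕ) :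
    ∑ᶠ p : ℕ × ℕ+, LaurentPolynomial.T (2 * (p.1 : ℤ) + ((p.2 : ℕ) : ℤ) - 2) *
      algebraMap ℚ HRing (((p.2 : ℕ).factorial : ℚ)⁻¹) *
      LaurentPolynomial.C (MvPowerSeries.coeff e
        (principalSpecialization (primitive (Omega a p.1 p.2)))) =
      if e 1 = 0 then PowerSeries.coeff (e 0) (exponentSeries a) else 0 := by
  classical
  by_cases h1 : e 1 = 0
  swap
  · rw [if_neg h1]
    refine (finsum_congr fun p => ?_).trans finsum_zero
    rw [coeff_principalSpecialization_eq, if_neg h1, map_zero, mul_zero]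
  rw [if_pos h1, exponentSeries, PowerSeries.coeff_mk]
  by_cases h0 : e 0 = 0
  · rw [if_pos h0]
    refine (finsum_congr fun p => ?_).trans finsum_zero
    rw [coeff_principalSpecialization_eq_zero a _ _ e p.2.pos (Or.inl (h0 ▸ p.2.pos)), map_zero,
      mul_zero]
  rw [if_neg h0]
  set d := e 0 with hd
  have : Nonempty (Fin d) := ⟨⟨0, Nat.pos_of_ne_zero h0⟩⟩
  let F : (Fin 2 → Equiv.Perm (Fin d)) → ℕ × ℕ+ → HRing := fun s p =>
    if middleCard s = (p.2 : ℕ) ∧ (cycleLengths (s 0)).card + middleCard s +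
        (cycleLengths (s 1)).card + 2 * p.1 = d + 2 then
      ((d.factorial : ℚ)⁻¹) • ((-hbar) ^ d * tupleWeight (pairWeight a) s) else 0
  have hF : ∀ p : ℕ × ℕ+, LaurentPolynomial.T (2 * (p.1 : ℤ) + ((p.2 : ℕ) : ℤ) - 2) *
      algebraMap ℚ HRing (((p.2 : ℕ).factorial : ℚ)⁻¹) *
      LaurentPolynomial.C (MvPowerSeries.coeff e
        (principalSpecialization (primitive (Omega a p.1 p.2)))) =
      ∑ s ∈ univ.filter fun s : Fin 2 → Equiv.Perm (Fin d) => IsTransitive s, F s p := by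
    intro p
    rw [coeff_principalSpecialization_eq, if_pos h1, map_rat_smul, mul_assoc, ← Algebra.smul_def,
      smul_smul, mul_comm, smul_mul_assoc, map_sum, Finset.sum_mul, Finset.smul_sum]
    refine Finset.sum_congr rfl fun s _ => ?_
    have hq : (((p.2 : ℕ).factorial : ℚ)⁻¹ * (((e 0).factorial : ℚ)⁻¹ *
        ((p.2 : ℕ).factorial : ℚ))) = (d.factorial : ℚ)⁻¹ := by
      have : ((p.2 : ℕ).factorial : ℚ) ≠ 0 := by positivity
      rw [hd]
      field_simp
    rw [hq]
    simp only [F]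
    split_ifs with hs
    · rw [tupleWeight_pairWeight a s hs.1 hs.2, mul_comm]
    · simp
  have hpt : ∀ s : Fin 2 → Equiv.Perm (Fin d), IsTransitive s → ∃ p₀ : ℕ × ℕ+,
      F s p₀ = ((d.factorial : ℚ)⁻¹) • ((-hbar) ^ d * tupleWeight (pairWeight a) s) ∧
      ∀ p, p ≠ p₀ → F s p = 0 := by
    intro s hs
    have hs' : IsTransitive ![s 0, s 1] := by
      convert hs using 1
      funext i
      fin_cases i <;> rfl
    obtain ⟨g, hg⟩ := hs'.exists_genus (y := (s 1 * s 0)⁻¹) (by simp)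
    have hg' : (cycleLengths (s 0)).card + middleCard s + (cycleLengths (s 1)).card + 2 * g =
      d + 2 := hg.trans (by rw [Fintype.card_fin])
    have hpos : 0 < middleCard s := by
      rw [middleCard, cycleLengths, card_parts_partition]
      exact Nat.card_pos_iff.2 ⟨⟨Quotient.mk _ (Classical.arbitrary _)⟩, inferInstance⟩
    refine ⟨(g, ⟨middleCard s, hpos⟩), if_pos ⟨rfl, hg'⟩, fun p hp => if_neg ?_⟩
    rintro ⟨h2, h3⟩
    refine hp (Prod.ext ?_ (PNat.coe_injective h2.symm))
    change p.1 = g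
    omega
  rw [finsum_congr hF, finsum_sum_comm]
  · rw [transitiveSum, Finset.mul_sum, Finset.smul_sum]
    refine Finset.sum_congr rfl fun s hs => ?_
    obtain ⟨p₀, h2, h3⟩ := hpt s (mem_filter.1 hs).2
    rw [finsum_eq_single _ p₀ h3, h2]
  · intro s hs
    obtain ⟨p₀, h2, h3⟩ := hpt s (mem_filter.1 hs).2
    exact (Set.finite_singleton p₀).subset fun p hp => by
      by_contra hne
      exact hp (h3 p hne)

theorem waveExponent_eq (a : ℕ) :
    waveExponent a = (LaurentPolynomial.T (-1) : HRing) • (logx : LogSeries HRing) +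
      (exponentSeries a).subst (invx : LogSeries HRing) := by
  classical
  ext e : 1
  rw [map_add, coeff_subst_invx, ← finsum_coeff_waveTerm]
  change (∑ᶠ p : ℕ × ℕ+, MvPowerSeries.coeff e (waveTerm a p.1 p.2)) = _
  let A : ℕ × ℕ+ → HRing := fun p =>
    if p = (0, 1) then MvPowerSeries.coeff e ((LaurentPolynomial.T (-1) : HRing) • logx) else 0
  let B : ℕ × ℕ+ → HRing := fun p => LaurentPolynomial.T (2 * (p.1 : ℤ) + ((p.2 : ℕ) : ℤ) - 2) *
      algebraMap ℚ HRing (((p.2 : ℕ).factorial : ℚ)⁻¹) *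
      LaurentPolynomial.C (MvPowerSeries.coeff e
        (principalSpecialization (primitive (Omega a p.1 p.2))))
  have hAB : ∀ p : ℕ × ℕ+, MvPowerSeries.coeff e (waveTerm a p.1 p.2) = A p + B p := by
    rintro ⟨g, n⟩
    have hif : (g = 0 ∧ (n : ℕ) = 1) ↔ (g, n) = ((0, 1) : ℕ × ℕ+) := by
      rw [Prod.mk.injEq, PNat.coe_eq_one_iff]
    simp only [waveTerm, freeEnergy, A, B, MvPowerSeries.coeff_smul, MvPowerSeries.coeff_map,
      map_add, mul_add, hif]
    congr 1
    split_ifs with h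
    · obtain ⟨rfl, rfl⟩ := Prod.mk.inj h
      simp only [logx, MvPowerSeries.coeff_X]
      split_ifs <;> simp
    · simp
  have hA : (Function.support A).Finite :=
    (Set.finite_singleton ((0, 1) : ℕ × ℕ+)).subset fun p hp => by
      by_contra hne
      exact hp (if_neg hne)
  have hB : (Function.support B).Finite := by
    refine ((finite_support_waveTerm a e).union hA).subset fun p hp => ?_
    by_contra hne
    simp only [Set.mem_union, Function.mem_support, not_or, not_not] at hne
    rw [hAB, hne.2, zero_add] at hne
    exact hp hne.1
  rw [finsum_congr hAB, finsum_add_distrib hA hB, finsum_eq_single A (0, 1) fun p hp => if_neg hp]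
  simp only [A, if_true]
  rfl

end Exponent

/-! ### The wave function as a sum over all pairs of permutations -/

section WaveFunction

/-- The coefficients of the exponential of `-(1/ħ) ∑ t_i z^i / i`. -/
def poleCoeff (a d : ℕ) : HRing :=
  ((d.factorial : ℚ)⁻¹) • ∑ s : Equiv.Perm (Fin d), cycleWeight (poleWeight a) s

/-- The wave function divided by `x ^ (1/ħ)`, as a series in `x⁻¹`. -/
def totalSeries (a : ℕ) : PowerSeries HRing := PowerSeries.mk fun d =>
  ((d.factorial : ℚ)⁻¹) • ((-hbar) ^ d * totalSum (pairWeight a) (Fin d))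

lemma hbar_mul_T_neg_one : hbar * LaurentPolynomial.T (-1) = 1 := by
  rw [hbar, ← LaurentPolynomial.T_add]
  simp

lemma coeff_totalSeries (a d : ℕ) :
    PowerSeries.coeff d (totalSeries a) =
      (∏ j ∈ range d, (1 - hbar * (j : HRing))) * poleCoeff a d := by
  have h : (-hbar) ^ d * ∏ j ∈ range d, (-LaurentPolynomial.T (-1) + (j : HRing)) =
      ∏ j ∈ range d, (1 - hbar * (j : HRing)) := by
    rw [← card_range d, ← Finset.prod_const, card_range, ← Finset.prod_mul_distrib]
    refine Finset.prod_congr rfl fun j _ => ?_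
    linear_combination hbar_mul_T_neg_one
  rw [totalSeries, PowerSeries.coeff_mk, totalSum_eq_prod, Fin.prod_univ_two]
  simp only [pairWeight, Matrix.cons_val_zero, Matrix.cons_val_one]
  rw [sum_cycleWeight_const, ← mul_assoc, h, poleCoeff, mul_smul_comm]

lemma poleCoeff_recurrence (a d : ℕ) :
    hbar * ((d : HRing) * poleCoeff a d) +
      ∑ i ∈ Icc 1 a, t i * (if i ≤ d then poleCoeff a (d - i) else 0) = 0 := by
  rcases d with _ | d
  · rw [Finset.sum_eq_zero fun i hi => ?_]
    · simp
    · rw [if_neg (by have := (mem_Icc.1 hi).1; omega), mul_zero]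
  · have h := sum_cycleWeight_div_factorial (poleWeight a) d
    have h1 : ∑ m ∈ range (d + 1), poleWeight a (d + 1 - m) * poleCoeff a m =
        -LaurentPolynomial.T (-1) * ∑ i ∈ Icc 1 a, t i *
          (if i ≤ d + 1 then poleCoeff a (d + 1 - i) else 0) := by
      rw [Finset.mul_sum]
      simp_rw [mul_ite, mul_zero]
      rw [← Finset.sum_filter]
      have h2 : ∀ m ∈ range (d + 1), poleWeight a (d + 1 - m) * poleCoeff a m =
          if d + 1 - m ≤ a then -LaurentPolynomial.T (-1) * (t (d + 1 - m) * poleCoeff a m)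
          else 0 := by
        intro m _
        rw [poleWeight, truncatedParameter, t]
        split_ifs
        · rw [mul_assoc]
        · rw [map_zero, mul_zero, zero_mul]
      rw [Finset.sum_congr rfl h2, ← Finset.sum_filter]
      refine Finset.sum_bij' (fun m _ => d + 1 - m) (fun i _ => d + 1 - i) ?_ ?_ ?_ ?_ ?_
      · intro m hm
        simp only [mem_filter, mem_range, mem_Icc] at hm ⊢
        omega
      · intro i hi
        simp only [mem_filter, mem_range, mem_Icc] at hi ⊢
        omega
      · intro m hm
        simp only [mem_filter, mem_range] at hm
        omega
      · intro i hi
        simp only [mem_filter, mem_Icc] at hi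
        omega
      · intro m hm
        simp only [mem_filter, mem_range] at hm
        rw [show d + 1 - (d + 1 - m) = m by omega]
    change ((d + 1 : ℕ) : HRing) * poleCoeff a (d + 1) =
      ∑ m ∈ range (d + 1), poleWeight a (d + 1 - m) * poleCoeff a m at h
    rw [h, h1]
    linear_combination (-(∑ i ∈ Icc 1 a, t i *
          (if i ≤ d + 1 then poleCoeff a (d + 1 - i) else 0))) * hbar_mul_T_neg_one

lemma derivative_totalSeries (a : ℕ) :
    PowerSeries.derivative HRing (totalSeries a) =
      totalSeries a * PowerSeries.derivative HRing (exponentSeries a) := by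
  ext d : 1
  rw [PowerSeries.coeff_derivative, PowerSeries.coeff_mul,
    Finset.Nat.sum_antidiagonal_eq_sum_range_succ_mk, totalSeries, PowerSeries.coeff_mk,
    totalSum_succ, Finset.mul_sum, Finset.smul_sum, Finset.sum_mul]
  refine Finset.sum_congr rfl fun m hm => ?_
  have hm' : m ≤ d := Nat.lt_succ_iff.1 (mem_range.1 hm)
  obtain ⟨k, rfl⟩ : ∃ k, d = m + k := ⟨d - m, by omega⟩
  rw [PowerSeries.coeff_mk, PowerSeries.coeff_derivative, exponentSeries, PowerSeries.coeff_mk,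
    Nat.add_sub_cancel_left, if_neg (by omega), show m + k + 1 - m = k + 1 by omega]
  have hq : ((m + k + 1).factorial : ℚ)⁻¹ * ((m + k).choose m : ℚ) * ((m + k : ℕ) + 1 : ℚ) =
      (m.factorial : ℚ)⁻¹ * ((k + 1).factorial : ℚ)⁻¹ * ((k : ℚ) + 1) := by
    have h := Nat.choose_mul_factorial_mul_factorial (Nat.le_add_right m k)
    rw [Nat.add_sub_cancel_left] at h
    have h' : ((m + k).choose m : ℚ) * m.factorial * k.factorial = (m + k).factorial := by
      exact_mod_cast h
    have h1 : (m.factorial : ℚ) ≠ 0 := by positivity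
    have h2 : (k.factorial : ℚ) ≠ 0 := by positivity
    have h3 : ((m + k).factorial : ℚ) ≠ 0 := by positivity
    have h4 : (m : ℚ) + k + 1 ≠ 0 := by positivity
    have h5 : (k : ℚ) + 1 ≠ 0 := by positivity
    rw [Nat.factorial_succ, Nat.factorial_succ]
    push_cast
    field_simp
    linarith
  have hS := congrArg (algebraMap ℚ HRing) hq
  simp only [map_mul, map_add, map_natCast, map_one] at hS
  simp only [Algebra.smul_def]
  linear_combination ((-hbar) ^ (m + k + 1) * (totalSum (pairWeight a) (Fin m) *
    transitiveSum (pairWeight a) (Fin (k + 1)))) * hS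

lemma constantCoeff_subst_invx (f : PowerSeries HRing) :
    MvPowerSeries.constantCoeff (f.subst (invx : LogSeries HRing)) =
      PowerSeries.constantCoeff f := by
  rw [← MvPowerSeries.coeff_zero_eq_constantCoeff_apply, coeff_subst_invx]
  simp

/-- The series `x ^ (1/ħ) = exp (ħ⁻¹ log x)`. -/
def prefactor : LogSeries HRing :=
  (PowerSeries.exp HRing).subst ((LaurentPolynomial.T (-1) : HRing) • (logx : LogSeries HRing))

lemma constantCoeff_smul_logx : MvPowerSeries.constantCoeff
    ((LaurentPolynomial.T (-1) : HRing) • (logx : LogSeries HRing)) = 0 := by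
  simp [logx, MvPowerSeries.smul_eq_C_mul]

theorem waveFunction_eq (a : ℕ) :
    waveFunction a = prefactor * (totalSeries a).subst (invx : LogSeries HRing) := by
  have hX : MvPowerSeries.constantCoeff (invx : LogSeries HRing) = 0 := by simp [invx]
  have hs : PowerSeries.HasSubst (invx : LogSeries HRing) :=
    PowerSeries.HasSubst.of_constantCoeff_zero hX
  have : IsAddTorsionFree HRing := .of_module_rat _
  refine (eq_exp_subst (constantCoeff_waveExponent a) ?_ fun i => ?_).symm
  · rw [map_mul, prefactor, constantCoeff_exp_subst constantCoeff_smul_logx,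
      constantCoeff_subst_invx, ← PowerSeries.coeff_zero_eq_constantCoeff_apply, coeff_totalSeries]
    simp [poleCoeff, cycleWeight_eq]
  · rw [Derivation.leibniz, prefactor, pderiv_exp_subst i constantCoeff_smul_logx,
      pderiv_subst i hX, derivative_totalSeries, PowerSeries.subst_mul hs, waveExponent_eq, map_add,
      pderiv_subst i hX]
    simp only [smul_eq_mul]
    ring

/-- The action of `ħ x d/dx` on series in `x⁻¹` multiplied by `x ^ (1/ħ)`. -/
def eulerOperator (f : PowerSeries HRing) : PowerSeries HRing :=
  f - PowerSeries.C hbar * (PowerSeries.X * PowerSeries.derivative HRing f)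

lemma coeff_eulerOperator (f : PowerSeries HRing) (d : ℕ) :
    PowerSeries.coeff d (eulerOperator f) = (1 - hbar * (d : HRing)) * PowerSeries.coeff d f := by
  rw [eulerOperator, map_sub, PowerSeries.coeff_C_mul]
  rcases d with _ | d
  · simp
  · rw [PowerSeries.coeff_succ_X_mul, PowerSeries.coeff_derivative]
    push_cast
    ring

lemma coeff_iterate_X_mul_eulerOperator (f : PowerSeries HRing) (i d : ℕ) :
    PowerSeries.coeff d ((fun f => PowerSeries.X * eulerOperator f)^[i] f) =
      if i ≤ d then (∏ j ∈ Ico (d - i) d, (1 - hbar * (j : HRing))) * PowerSeries.coeff (d - i) f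
      else 0 := by
  induction i generalizing d with
  | zero => simp
  | succ i ih =>
    rw [Function.iterate_succ_apply']
    rcases d with _ | d
    · simp
    · rw [PowerSeries.coeff_succ_X_mul, coeff_eulerOperator, ih]
      simp only [Nat.add_le_add_iff_right, Nat.add_sub_add_right]
      split_ifs with h
      · rw [Finset.prod_Ico_succ_top (by omega)]
        ring
      · simp

lemma hbar_smul_xddx (f : PowerSeries HRing) :
    hbar • xddx (prefactor * f.subst (invx : LogSeries HRing)) =
      prefactor * (eulerOperator f).subst (invx : LogSeries HRing) := by
  have hX : MvPowerSeries.constantCoeff (invx : LogSeries HRing) = 0 := by simp [invx]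
  have hs : PowerSeries.HasSubst (invx : LogSeries HRing) :=
    PowerSeries.HasSubst.of_constantCoeff_zero hX
  have hp : ∀ i, MvPowerSeries.pderiv HRing i prefactor = prefactor *
      (LaurentPolynomial.T (-1) : HRing) • MvPowerSeries.pderiv HRing i (MvPowerSeries.X 1) := by
    intro i
    rw [prefactor, pderiv_exp_subst i constantCoeff_smul_logx, Derivation.map_smul]
    rfl
  have hL : xddx prefactor = MvPowerSeries.C (LaurentPolynomial.T (-1) : HRing) * prefactor := by
    simp only [xddx, Derivation.add_apply, Derivation.smul_apply, hp]
    simp [MvPowerSeries.smul_eq_C_mul, mul_comm]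
  have hq : ∀ i, MvPowerSeries.pderiv HRing i (f.subst (invx : LogSeries HRing)) =
      (PowerSeries.derivative HRing f).subst (invx : LogSeries HRing) *
        MvPowerSeries.pderiv HRing i (MvPowerSeries.X 0) := fun i => pderiv_subst i hX f
  have hf : xddx (f.subst (invx : LogSeries HRing)) =
      -(invx * (PowerSeries.derivative HRing f).subst (invx : LogSeries HRing)) := by
    simp only [xddx, Derivation.add_apply, Derivation.smul_apply, hq]
    simp
    ring
  have hc : (MvPowerSeries.C hbar * MvPowerSeries.C (LaurentPolynomial.T (-1)) : LogSeries HRing) =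
      1 := by
    rw [← map_mul, hbar_mul_T_neg_one, map_one]
  rw [Derivation.leibniz, hL, hf, eulerOperator, PowerSeries.subst_sub hs,
    PowerSeries.subst_mul hs, PowerSeries.subst_mul hs, PowerSeries.subst_C, PowerSeries.subst_X hs,
    MvPowerSeries.smul_eq_C_mul]
  simp only [smul_eq_mul]
  linear_combination prefactor * f.subst (invx : LogSeries HRing) * hc

lemma hbar_smul_ddx (f : PowerSeries HRing) :
    hbar • ddx (prefactor * f.subst (invx : LogSeries HRing)) =
      prefactor * (PowerSeries.X * eulerOperator f).subst (invx : LogSeries HRing) := by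
  have hs : PowerSeries.HasSubst (invx : LogSeries HRing) :=
    PowerSeries.HasSubst.of_constantCoeff_zero (by simp [invx])
  rw [ddx_eq_invx_mul_xddx, ← mul_smul_comm, hbar_smul_xddx, PowerSeries.subst_mul hs,
    PowerSeries.subst_X hs]
  ring

lemma hbar_smul_ddx_pow (i : ℕ) (f : PowerSeries HRing) :
    ((hbar • (ddx (R := HRing)).toLinearMap) ^ i : Module.End HRing (LogSeries HRing))
        (prefactor * f.subst (invx : LogSeries HRing)) =
      prefactor * ((fun f => PowerSeries.X * eulerOperator f)^[i] f).subst
        (invx : LogSeries HRing) := by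
  induction i with
  | zero => simp
  | succ i ih =>
    rw [pow_succ', Module.End.mul_apply, ih, Function.iterate_succ_apply', ← hbar_smul_ddx]
    rfl

lemma totalSeries_equation (a : ℕ) :
    -eulerOperator (totalSeries a) + totalSeries a + ∑ i ∈ Icc 1 a, PowerSeries.C (t i) *
      (fun f => PowerSeries.X * eulerOperator f)^[i] (totalSeries a) = 0 := by
  ext d : 1
  rw [map_add, map_add, map_neg, map_sum, coeff_eulerOperator, map_zero]
  have h : ∀ i ∈ Icc 1 a, PowerSeries.coeff d (PowerSeries.C (t i) *
      (fun f => PowerSeries.X * eulerOperator f)^[i] (totalSeries a)) =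
      (∏ j ∈ range d, (1 - hbar * (j : HRing))) *
        (t i * (if i ≤ d then poleCoeff a (d - i) else 0)) := by
    intro i _
    rw [PowerSeries.coeff_C_mul, coeff_iterate_X_mul_eulerOperator, coeff_totalSeries]
    split_ifs
    · rw [← Finset.prod_range_mul_prod_Ico _ (Nat.sub_le d i)]
      ring
    · simp
  rw [Finset.sum_congr rfl h, ← Finset.mul_sum, coeff_totalSeries]
  linear_combination (∏ j ∈ range d, (1 - hbar * (j : HRing)) : HRing) * poleCoeff_recurrence a d

end WaveFunction

end Hypermap

end

theorem mainTheorem2 (a : ℕ) (ha : 1 ≤ a) :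
    (-(Hypermap.hbar • (Hypermap.xddx (R := Hypermap.HRing)).toLinearMap) + 1 +
        ∑ i ∈ Finset.Icc 1 a,
          Hypermap.t i • (Hypermap.hbar • (Hypermap.ddx (R := Hypermap.HRing)).toLinearMap) ^ i :
      Module.End Hypermap.HRing (Hypermap.LogSeries Hypermap.HRing))
      (Hypermap.waveFunction a) = 0 := by
  have hs : PowerSeries.HasSubst (Hypermap.invx : Hypermap.LogSeries Hypermap.HRing) :=
    PowerSeries.HasSubst.of_constantCoeff_zero (by simp [Hypermap.invx])
  have h := congrArg (PowerSeries.subst (Hypermap.invx : Hypermap.LogSeries Hypermap.HRing))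
    (Hypermap.totalSeries_equation a)
  rw [← PowerSeries.coe_substAlgHom hs, map_add, map_add, map_neg, map_sum, map_zero] at h
  simp only [map_mul, PowerSeries.coe_substAlgHom, PowerSeries.subst_C] at h
  rw [Hypermap.waveFunction_eq, LinearMap.add_apply, LinearMap.add_apply, LinearMap.neg_apply,
    LinearMap.sum_apply, LinearMap.smul_apply, Module.End.one_apply]
  simp only [LinearMap.smul_apply, Hypermap.hbar_smul_ddx_pow, Derivation.coeFn_coe,
    Hypermap.hbar_smul_xddx]
  simp only [MvPowerSeries.smul_eq_C_mul, mul_left_comm _ Hypermap.prefactor, ← Finset.mul_sum]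
  linear_combination Hypermap.prefactor * h
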